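/- Let $\mathbb F$ be an algebraically closed field of characteristic $p>2$, let $m\ge 1$, and let $\lambda=(\lambda_1,\dots,\lambda_m)\in(\mathbb F^\times)^m$ satisfy $\lambda_1^{p-1}=\dots=\lambda_m^{p-1}=:|\lambda|$. The twisted Heisenberg Lie algebra $\mathfrak h_m^\lambda$ has basis $e_1,\dots,e_{2m+2}$ and the non-vanishing brackets $[e_i,e_{m+i}]=e_{2m+1}$, $[e_{2m+2},e_i]=\lambda_i e_{m+i}$, $[e_{2m+2},e_{m+i}]=\lambda_i e_i$ for $1\le i\le m$. For every $\mu\in\mathbb F^{2m+2}$ there is exactly one $[p]$-operator on $\mathfrak h_m^\lambda$ with $e_i^{[p]}=\mu_i e_{2m+1}$ for $1\le i\le 2m+1$ and $e_{2m+2}^{[p]}=|\lambda| e_{2m+2}+\mu_{2m+2}e_{2m+1}$; the resulting restricted Lie algebra is denoted $\mathfrak h_m^{\lambda,\mu}$. Every restricted structure on $\mathfrak h_m^\lambda$ is of this form. Notation. For a restricted Lie algebra $\mathfrak g$ over $\mathbb F$ let $[g_1,\dots,g_j]=[[\dots[g_1,g_2],\dots],g_j]$. Given $\varphi\in(\wedge^2\mathfrak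 g)^*$, a map $\omega:\mathfrak g\to\mathbb F$ is $\varphi$-compatible if $\omega(ag)=a^p\omega(g)$ and $$\omega(g+h)=\omega(g)+\omega(h)+\sum_{\substack{g_i\in\{g,h\}\\ g_1=g,\ g_2=h}}\frac1{\#(g)}\,\varphi([g_1,\dots,g_{p-1}]\wedge g_p)$$ for all $a\in\mathbb F$, $g,h\in\mathfrak g$, where the sum is over all words $g_1\cdots g_p$ in the letters $g$ and $h$ as indicated and $\#(g)$ is the number of letters $g$. A restricted 2-cocycle (with trivial coefficients) is a pair $(\varphi,\omega)$ with $\omega$ $\varphi$-compatible, with $\varphi([g,h]\wedge f)-\varphi([g,f]\wedge h)+\varphi([h,f]\wedge g)=0$ for all $g,h,f$, and with $\varphi(g\wedge h^{[p]})=\varphi([g,h,\dots,h]\wedge h)$ ($p-1$ letters $h$ in the bracket) for all $g,h$. The coboundaries are the pairs $\big(g\wedge h\mapsto\psi([g,h]),\ g\mapsto\psi(g^{[p]})\big)$ with $\psi\in\mathfrak g^*$, and $H^2_*(\mathfrak g)$ is the space of restricted 2-cocycles modulo coboundaries. Let $e^{i,j}$ be the dual basis of $\{e_i\wedge e_j\}_{i<j}$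 (with $e^{j,i}=-e^{i,j}$), and let $\overline e^i(\sum_j a_je_j)=a_i^p$. Theorem. For each of the following $\varphi$ there is exactly one $\varphi$-compatible map $\widetilde\varphi:\mathfrak h_m^{\lambda}\to\mathbb F$ with $\widetilde\varphi(e_k)=0$ for $1\le k\le 2m+2$: (a) $\varphi=e^{i,j}-\lambda_i\lambda_j^{-1}e^{m+i,m+j}$, for $1\le i<j\le m$ with $\lambda_i=\pm\lambda_j$; (b) $\varphi=e^{i,m+j}-\lambda_i\lambda_j^{-1}e^{m+i,j}$, for $1\le i<j\le m$ with $\lambda_i=\pm\lambda_j$; (c) $\varphi=e^{i,m+i}$, for $1\le i\le m-1$. For every $\mu\in\mathbb F^{2m+2}$, $$\dim H^2_*(\mathfrak h_m^{\lambda,\mu})=2\cdot\#\{(i,j)\mid 1\le i<j\le m,\ \lambda_i=\pm\lambda_j\}+3m,$$ and the following pairs are restricted 2-cocycles whose classes form a basis of $H^2_*(\mathfrak h_m^{\lambda,\mu})$: the pairs $(\varphi,\widetilde\varphi)$ for all $\varphi$ in (a), (b), (c), together with the pairs $(0,\overline e^i)$ for $1\le i\le 2m+1$. -/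

import Mathlib

open scoped TensorProduct Polynomial

noncomputable section

section RestrictedLie

variable (F : Type*) [Field F] (p : ℕ) {L : Type*} [LieRing L] [LieAlgebra F L]

/-- The coefficient in `L` of `t ^ n` of an element of `F[t] ⊗ L`. -/
def tensorCoeff (n : ℕ) : F[X] ⊗[F] L →ₗ[F] L :=
  (TensorProduct.lid F L).toLinearMap ∘ₗ (Polynomial.lcoeff F n).rTensor L

/-- `s_i(g, h)`: the element such that `i s_i(g, h)` is the coefficient of `t ^ (i - 1)` in
`(ad (t g + h)) ^ (p - 1) (g)`, computed in the Lie algebra `F[t] ⊗ L`. It is used only for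
`1 ≤ i ≤ p - 1`. -/
def jacobsonTerm (i : ℕ) (g h : L) : L :=
  (i : F)⁻¹ • tensorCoeff F (i - 1)
    (((LieAlgebra.ad F[X] (F[X] ⊗[F] L)
        ((Polynomial.X : F[X]) ⊗ₜ[F] g + (1 : F[X]) ⊗ₜ[F] h)) ^ (p - 1)) ((1 : F[X]) ⊗ₜ[F] g))

variable (L) in
/-- A restricted structure on the Lie algebra `L`: a map `g ↦ g^[p]`, here `pow`, satisfying
the three axioms of a `[p]`-operator. -/
structure RestrictedStructure where
  /-- The `[p]`-operator. -/
  pow : L → L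
  pow_smul : ∀ (a : F) (g : L), pow (a • g) = a ^ p • pow g
  pow_add : ∀ g h : L,
    pow (g + h) = pow g + pow h + ∑ i ∈ Finset.Icc 1 (p - 1), jacobsonTerm F p i g h
  ad_pow : ∀ g : L, (LieAlgebra.ad F L g) ^ p = LieAlgebra.ad F L (pow g)

variable (L) in
/-- The space `C²(L) = (Λ² L)^*` of alternating bilinear forms; `φ(g ∧ h)` is `φ ![g, h]`. -/
abbrev Cochain2 := L [⋀^Fin 2]→ₗ[F] F

variable {F} in
/-- An alternating form given as a function of two variables. -/
def Cochain2.mk (B : L → L → F) (add_left : ∀ x x' y, B (x + x') y = B x y + B x' y)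
    (smul_left : ∀ (a : F) x y, B (a • x) y = a * B x y)
    (add_right : ∀ x y y', B x (y + y') = B x y + B x y')
    (smul_right : ∀ (a : F) x y, B x (a • y) = a * B x y)
    (self : ∀ x, B x x = 0) : Cochain2 F L where
  toFun v := B (v 0) (v 1)
  map_update_add' v i x y := by fin_cases i <;> simp [add_left, add_right]
  map_update_smul' v i a x := by fin_cases i <;> simp [smul_left, smul_right]
  map_eq_zero_of_eq' v i j hv hij := by fin_cases i <;> fin_cases j <;> simp_all

variable (L) in
/-- The space of all pairs `(φ, ω)` of a 2-cochain `φ` and a map `ω : L → F`. -/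
def CochainPair : Type _ := Cochain2 F L × (L → F)

instance : AddCommGroup (CochainPair F L) := inferInstanceAs (AddCommGroup (Cochain2 F L × (L → F)))

instance : Module F (CochainPair F L) := inferInstanceAs (Module F (Cochain2 F L × (L → F)))

variable {F} in
/-- The pair `(φ, ω)`. -/
def CochainPair.mk (φ : Cochain2 F L) (ω : L → F) : CochainPair F L := (φ, ω)

/-- The left-normed bracket `[w 1, w 2, …, w n] = [[…[w 1, w 2], …], w n]`, for `n ≥ 1`. -/
def leftBracket (w : ℕ → L) : ℕ → L
  | 0 => 0
  | 1 => w 1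
  | n + 2 => ⁅leftBracket w (n + 1), w (n + 2)⁆

open Classical in
/-- The word in `g` and `h` whose letter at position `i` is `g` exactly when `i ∈ S`. -/
def word (S : Finset ℕ) (g h : L) (i : ℕ) : L := if i ∈ S then g else h

variable {F} in
/-- The sum, over all words `g_1 … g_p` in `g` and `h` with `g_1 = g` and `g_2 = h`, of
`(1 / #(g)) φ([g_1, …, g_{p-1}] ∧ g_p)`; a word is given by the set `S ⊆ {1, …, p}` of the
positions of `g`, so that `#(g) = #S`. -/
def compatSum (φ : Cochain2 F L) (g h : L) : F :=
  ∑ S ∈ (Finset.Icc 1 p).powerset with 1 ∈ S ∧ 2 ∉ S,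
    (S.card : F)⁻¹ * φ ![leftBracket (word S g h) (p - 1), word S g h p]

variable {F} in
/-- `ω : L → F` is `φ`-compatible. -/
def IsCompatible (φ : Cochain2 F L) (ω : L → F) : Prop :=
  (∀ (a : F) (g : L), ω (a • g) = a ^ p * ω g) ∧
    ∀ g h : L, ω (g + h) = ω g + ω h + compatSum p φ g h

variable (L) in
/-- The space `C²_*(L)` of restricted 2-cochains `(φ, ω)`. -/
def restrictedCochain2 : Submodule F (CochainPair F L) where
  carrier := {c | IsCompatible p c.1 c.2}
  add_mem' := by
    rintro ⟨φ, ω⟩ ⟨φ', ω'⟩ ⟨h1, h2⟩ ⟨h1', h2'⟩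
    refine ⟨fun a g => ?_, fun g h => ?_⟩
    · change ω (a • g) + ω' (a • g) = a ^ p * (ω g + ω' g)
      rw [show ω (a • g) = _ from h1 a g, show ω' (a • g) = _ from h1' a g]; ring
    · change ω (g + h) + ω' (g + h) = (ω g + ω' g) + (ω h + ω' h) + compatSum p (φ + φ') g h
      rw [show ω (g + h) = _ from h2 g h, show ω' (g + h) = _ from h2' g h]
      simp only [compatSum, AlternatingMap.add_apply, mul_add, Finset.sum_add_distrib]
      ring
  zero_mem' := by
    refine ⟨fun a g => ?_, fun g h => ?_⟩
    · change (0 : F) = a ^ p * 0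
      simp
    · change (0 : F) = 0 + 0 + compatSum p 0 g h
      simp [compatSum]
  smul_mem' := by
    rintro r ⟨φ, ω⟩ ⟨h1, h2⟩
    refine ⟨fun a g => ?_, fun g h => ?_⟩
    · change r * ω (a • g) = a ^ p * (r * ω g)
      rw [show ω (a • g) = _ from h1 a g]; ring
    · change r * ω (g + h) = r * ω g + r * ω h + compatSum p (r • φ) g h
      rw [show ω (g + h) = _ from h2 g h]
      simp only [compatSum, AlternatingMap.smul_apply, smul_eq_mul, mul_add, Finset.mul_sum]
      congr 1
      exact Finset.sum_congr rfl fun _ _ => by ring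

variable {F p}

/-- `d¹ψ (g ∧ h) = ψ [g, h]`. -/
def d1 : Module.Dual F L →ₗ[F] Cochain2 F L where
  toFun ψ := Cochain2.mk (fun g h => ψ ⁅g, h⁆) (by simp) (by simp) (by simp) (by simp) (by simp)
  map_add' _ _ := by ext; rfl
  map_smul' _ _ := by ext; rfl

/-- `d²φ (g ∧ h ∧ f) = φ([g, h] ∧ f) - φ([g, f] ∧ h) + φ([h, f] ∧ g)`. -/
def d2 : Cochain2 F L →ₗ[F] L → L → L → F where
  toFun φ g h f := φ ![⁅g, h⁆, f] - φ ![⁅g, f⁆, h] + φ ![⁅h, f⁆, g]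
  map_add' _ _ := by
    ext; simp only [AlternatingMap.add_apply, Pi.add_apply]; ring
  map_smul' _ _ := by
    ext
    simp only [AlternatingMap.smul_apply, Pi.smul_apply, smul_eq_mul, RingHom.id_apply]
    ring

/-- `d¹_* ψ = (d¹ψ, ind¹ψ)`, where `ind¹ψ (g) = ψ(g^[p])`. -/
def d1Star (P : RestrictedStructure F p L) : Module.Dual F L →ₗ[F] CochainPair F L where
  toFun ψ := CochainPair.mk (d1 ψ) (fun g => ψ (P.pow g))
  map_add' ψ ψ' := by rw [map_add]; rfl
  map_smul' r ψ := by rw [map_smul]; rfl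

/-- `d²_* (φ, ω) = (d²φ, ind²(φ, ω))`, where
`ind²(φ, ω)(g, h) = φ(g ∧ h^[p]) - φ([g, h, …, h] ∧ h)` with `p - 1` letters `h` in the bracket.
On `C²_*(L)` the values lie in the space `C³_*(L)` of restricted 3-cochains, which is a subspace
of the target written here; only the kernel matters for the second cohomology. -/
def d2Star (P : RestrictedStructure F p L) :
    CochainPair F L →ₗ[F] (L → L → L → F) × (L → L → F) where
  toFun c := (d2 c.1,
    fun g h => c.1 ![g, P.pow h] - c.1 ![(fun x => ⁅x, h⁆)^[p - 1] g, h])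
  map_add' := by
    rintro ⟨φ, ω⟩ ⟨φ', ω'⟩
    refine Prod.ext (map_add d2 φ φ') ?_
    ext g h
    change (φ + φ') _ - (φ + φ') _ = (φ _ - φ _) + (φ' _ - φ' _)
    simp only [AlternatingMap.add_apply]
    ring
  map_smul' := by
    rintro r ⟨φ, ω⟩
    refine Prod.ext (map_smul d2 r φ) ?_
    ext g h
    change (r • φ) _ - (r • φ) _ = r * (φ _ - φ _)
    simp only [AlternatingMap.smul_apply, smul_eq_mul]
    ring

/-- Restricted 2-cocycles: the kernel of `d²_*` on `C²_*`. -/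
def restrictedCocycle2 (P : RestrictedStructure F p L) :
    Submodule F (CochainPair F L) :=
  restrictedCochain2 F p L ⊓ LinearMap.ker (d2Star P)

/-- Restricted 2-coboundaries: the image of `d¹_*`. -/
def restrictedCoboundary2 (P : RestrictedStructure F p L) :
    Submodule F (CochainPair F L) :=
  LinearMap.range (d1Star P)

/-- The restricted cohomology space `H²_*(L)`, with trivial coefficients: cocycles modulo
coboundaries. -/
abbrev RestrictedH2 (P : RestrictedStructure F p L) : Type _ :=
  restrictedCocycle2 P ⧸ (restrictedCoboundary2 P).submoduleOf (restrictedCocycle2 P)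

/-- The class in `H²_*(L)` of a restricted 2-cocycle. -/
def restrictedClass (P : RestrictedStructure F p L) (c : CochainPair F L)
    (hc : c ∈ restrictedCocycle2 P) : RestrictedH2 P :=
  Submodule.Quotient.mk ⟨c, hc⟩

end RestrictedLie

/-- Indices of the standard basis of the twisted Heisenberg algebra: for `1 ≤ i ≤ m`,
`x i` stands for `i` and `y i` for `m + i`; `z` stands for `2m + 1` and `t` for `2m + 2`.
(Elements of `Fin m` are counted from `0`.) -/
inductive HIdx (m : ℕ) : Type
  | x (i : Fin m)
  | y (i : Fin m)
  | z
  | t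
  deriving DecidableEq

/-- The underlying space of the twisted Heisenberg Lie algebra: coordinate vectors `g`, standing
for `∑ k, g k • e_k`. -/
def TwistedHeisenberg {F : Type*} {m : ℕ} (_lam : Fin m → F) : Type _ := HIdx m → F

namespace TwistedHeisenberg

variable {F : Type*} [Field F] {m : ℕ} {lam : Fin m → F}

instance : AddCommGroup (TwistedHeisenberg lam) := inferInstanceAs (AddCommGroup (HIdx m → F))

instance : Module F (TwistedHeisenberg lam) := inferInstanceAs (Module F (HIdx m → F))

theorem add_apply (g h : TwistedHeisenberg lam) (k : HIdx m) : (g + h) k = g k + h k := rfl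

theorem smul_apply (a : F) (g : TwistedHeisenberg lam) (k : HIdx m) : (a • g) k = a * g k := rfl

theorem zero_apply (k : HIdx m) : (0 : TwistedHeisenberg lam) k = 0 := rfl

@[ext]
theorem ext {F : Type*} {m : ℕ} {lam : Fin m → F} {g h : TwistedHeisenberg lam} (H : ∀ k, g k = h k) : g = h := funext H

/-- The basis vector `e_k`. -/
def e (lam : Fin m → F) (k : HIdx m) : TwistedHeisenberg lam := fun l => if l = k then 1 else 0

/-- The bracket, in coordinates: the bilinear alternating extension of
`[e_i, e_{m+i}] = e_{2m+1}`, `[e_{2m+2}, e_i] = λ_i e_{m+i}`, `[e_{2m+2}, e_{m+i}] = λ_i e_i`,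
all other brackets of basis vectors being zero. -/
def bracket (g h : TwistedHeisenberg lam) : TwistedHeisenberg lam
  | .x i => lam i * (g .t * h (.y i) - h .t * g (.y i))
  | .y i => lam i * (g .t * h (.x i) - h .t * g (.x i))
  | .z => ∑ i, (g (.x i) * h (.y i) - h (.x i) * g (.y i))
  | .t => 0

instance : Bracket (TwistedHeisenberg lam) (TwistedHeisenberg lam) := ⟨bracket⟩

theorem lie_x (g h : TwistedHeisenberg lam) (i : Fin m) :
    ⁅g, h⁆ (.x i) = lam i * (g .t * h (.y i) - h .t * g (.y i)) := rfl

theorem lie_y (g h : TwistedHeisenberg lam) (i : Fin m) :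
    ⁅g, h⁆ (.y i) = lam i * (g .t * h (.x i) - h .t * g (.x i)) := rfl

theorem lie_z (g h : TwistedHeisenberg lam) :
    ⁅g, h⁆ .z = ∑ i, (g (.x i) * h (.y i) - h (.x i) * g (.y i)) := rfl

theorem lie_t (g h : TwistedHeisenberg lam) : ⁅g, h⁆ .t = 0 := rfl

instance : LieRing (TwistedHeisenberg lam) where
  add_lie a b c := by
    ext (i | i | _ | _) <;> simp only [lie_x, lie_y, lie_z, lie_t, add_apply]
    · ring
    · ring
    · rw [← Finset.sum_add_distrib]; exact Finset.sum_congr rfl fun _ _ => by ring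
    · ring
  lie_add a b c := by
    ext (i | i | _ | _) <;> simp only [lie_x, lie_y, lie_z, lie_t, add_apply]
    · ring
    · ring
    · rw [← Finset.sum_add_distrib]; exact Finset.sum_congr rfl fun _ _ => by ring
    · ring
  lie_self a := by
    ext (i | i | _ | _) <;> simp [lie_x, lie_y, lie_z, lie_t, zero_apply]
  leibniz_lie a b c := by
    ext (i | i | _ | _) <;> simp only [lie_x, lie_y, lie_z, lie_t, add_apply]
    · ring
    · ring
    · rw [← Finset.sum_add_distrib]; exact Finset.sum_congr rfl fun _ _ => by ring
    · ring

instance : LieAlgebra F (TwistedHeisenberg lam) where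
  lie_smul r a b := by
    ext (i | i | _ | _) <;> simp only [lie_x, lie_y, lie_z, lie_t, smul_apply]
    · ring
    · ring
    · rw [Finset.mul_sum]; exact Finset.sum_congr rfl fun _ _ => by ring
    · ring

/-- The 2-cochain `e^{k,l}`, dual to `e_k ∧ e_l` (for `k ≠ l`). -/
def e2 (lam : Fin m → F) (k l : HIdx m) : Cochain2 F (TwistedHeisenberg lam) :=
  Cochain2.mk (fun g h => g k * h l - g l * h k)
    (fun _ _ _ => by simp only [add_apply]; ring)
    (fun _ _ _ => by simp only [smul_apply]; ring)
    (fun _ _ _ => by simp only [add_apply]; ring)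
    (fun _ _ _ => by simp only [smul_apply]; ring)
    (fun _ => by ring)

/-- The Frobenius homomorphism `∑ j, a_j e_j ↦ a_k ^ p`. -/
def eBar (p : ℕ) (lam : Fin m → F) (k : HIdx m) : TwistedHeisenberg lam → F := fun g => g k ^ p

/-- The pairs `(i, j)` with `1 ≤ i < j ≤ m` and `λ_i = ± λ_j`. -/
abbrev Pairs (lam : Fin m → F) : Type :=
  {q : Fin m × Fin m // q.1 < q.2 ∧ (lam q.1 = lam q.2 ∨ lam q.1 = -lam q.2)}

/-- Index set of the 2-cocycles `ordCocycle`: two copies of the pairs `(i, j)` with `i < j` and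
`λ_i = ± λ_j`, and the indices `1 ≤ i ≤ m - 1` (that is, `i` is not the last one). -/
abbrev OrdIdx (lam : Fin m → F) : Type :=
  (Pairs lam ⊕ Pairs lam) ⊕ {i : Fin m // (i : ℕ) + 1 < m}

/-- The 2-cocycles `e^{i,j} - λ_i λ_j⁻¹ e^{m+i,m+j}` and `e^{i,m+j} - λ_i λ_j⁻¹ e^{m+i,j}`, for
`i < j` with `λ_i = ± λ_j`, and `e^{i,m+i}` for `1 ≤ i ≤ m - 1`. -/
def ordCocycle (lam : Fin m → F) : OrdIdx lam → Cochain2 F (TwistedHeisenberg lam)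
  | .inl (.inl ⟨(i, j), _⟩) =>
      e2 lam (.x i) (.x j) - (lam i * (lam j)⁻¹) • e2 lam (.y i) (.y j)
  | .inl (.inr ⟨(i, j), _⟩) =>
      e2 lam (.x i) (.y j) - (lam i * (lam j)⁻¹) • e2 lam (.y i) (.x j)
  | .inr ⟨i, _⟩ => e2 lam (.x i) (.y i)

/-- `ω` is the map `φ̃`: it is `φ`-compatible and vanishes on every basis vector. -/
def IsTilde (p : ℕ) (φ : Cochain2 F (TwistedHeisenberg lam)) (ω : TwistedHeisenberg lam → F) :
    Prop :=
  IsCompatible p φ ω ∧ ∀ k, ω (e lam k) = 0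

/-- The restricted structure `P` is the one with parameters `μ`, where `c` is the common value of
the `λ_i ^ (p - 1)`: `e_k^[p] = μ_k e_{2m+1}` for `1 ≤ k ≤ 2m + 1`, and
`e_{2m+2}^[p] = c e_{2m+2} + μ_{2m+2} e_{2m+1}`. -/
def HasParameters {p : ℕ} (P : RestrictedStructure F p (TwistedHeisenberg lam)) (c : F)
    (μ : HIdx m → F) : Prop :=
  (∀ k, k ≠ .t → P.pow (e lam k) = μ k • e lam .z) ∧
    P.pow (e lam .t) = c • e lam .t + μ .t • e lam .z

end TwistedHeisenberg

end

/-! Everything rests on a closed form for the sum over words. Appending a letter to a left-normed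
bracket applies minus its adjoint, so the words beginning with `g`, `h`, counted by their number of
letters `g`, have generating function `X • (-ad (X g + h)) ^ n ⁅g, h⁆` (`sum_words_leftBracket`).
Thus `compatSum` becomes a sum of `i⁻¹` times coefficients of index `i - 1`. For `φ = d1 ψ` it is
`ψ` of Jacobson's polynomial (`compatSum_d1`), so the coordinates of a `[p]`-operator are themselves
compatible maps, and one theory serves both notions. Two `φ`-compatible maps differ by an additive,
`p`-semilinear map, hence agree once they agree on a basis (`isCompatible_ext`); this is the
uniqueness of `φ̃` and of the `[p]`-operator.

For existence, on vectors without `t`-component `X g + h` acts modulo `e_z` as `T • ad e_t`, with `T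
= g_t X + h_t`. If `φ` kills `e_z`, its sum over words therefore comes from an explicit polynomial
`T ^ (p - 3) * (a X + b)`. A primitive of the form `f(X) = ω(X g + h)`, of degree at most `p`, makes
`ω` compatible: `f(1)` is `ω(g + h)`, and the coefficients of index `p` and `0` are `ω(g)` and
`ω(h)`. Such primitives are written down in `isCompatible_twist` and `isCompatible_d1_coord_aux`.

For the cohomology, the functionals `cohomCoord` vanish on coboundaries and are dual to the proposed
basis. Conversely, for a cocycle killed by all of them, `d²φ = 0` on triples containing `e_t` gives
2×2 systems of determinant `λ_i² - λ_j²`, and the restricted condition at `(e_z, e_t)` kills `φ(e_z,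
e_t)`. What is left of `φ` is a combination of `∑ e^{i,m+i}`, `e^{t,x_i}` and `e^{t,y_i}`, all
coboundaries; the remaining freedom in `ω` is the multiple of `e_t^*`, usable because `c ≠ 0`
(`cocycle_values`, `mem_range_d1Star`). -/

section General

variable {F : Type*} [Field F] {p : ℕ} {L : Type*} [LieRing L] [LieAlgebra F L]

/-! ### The sum over words as coefficients of iterated brackets in `F[X] ⊗ L`. -/

theorem tensorCoeff_tmul (n : ℕ) (f : F[X]) (g : L) :
    tensorCoeff F n (f ⊗ₜ[F] g) = f.coeff n • g := by
  simp [tensorCoeff]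

theorem tensorCoeff_X_smul (n : ℕ) (u : F[X] ⊗[F] L) :
    tensorCoeff F (n + 1) ((Polynomial.X : F[X]) • u) = tensorCoeff F n u := by
  induction u with
  | zero => simp
  | tmul f g => simp [TensorProduct.smul_tmul', tensorCoeff_tmul]
  | add u v hu hv => simp [smul_add, hu, hv]

/-- The operator `ad (X ⊗ g + 1 ⊗ h)` on `F[X] ⊗ L`. -/
noncomputable def polyAd (g h : L) : Module.End F[X] (F[X] ⊗[F] L) :=
  LieAlgebra.ad F[X] (F[X] ⊗[F] L) ((Polynomial.X : F[X]) ⊗ₜ[F] g + (1 : F[X]) ⊗ₜ[F] h)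

theorem polyAd_tmul (g h : L) (s : F[X]) (w : L) :
    polyAd g h (s ⊗ₜ[F] w) = (Polynomial.X * s) ⊗ₜ[F] ⁅g, w⁆ + s ⊗ₜ[F] ⁅h, w⁆ := by
  rw [polyAd, map_add, LinearMap.add_apply, LieAlgebra.ad_apply, LieAlgebra.ad_apply]
  simp

theorem neg_polyAd_pow_even (g h : L) (u : F[X] ⊗[F] L) (k : ℕ) :
    ((-polyAd g h) ^ (k + k)) u = (polyAd g h ^ (k + k)) u := by
  induction k with
  | zero => rfl
  | succ k ih =>
    rw [show k + 1 + (k + 1) = k + k + 1 + 1 by ring, pow_succ', pow_succ', pow_succ', pow_succ',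
      Module.End.mul_apply, Module.End.mul_apply, Module.End.mul_apply, Module.End.mul_apply, ih,
      LinearMap.neg_apply, LinearMap.neg_apply, map_neg, neg_neg]

theorem tensorCoeff_polyAd (n : ℕ) (g h : L) (u : F[X] ⊗[F] L) :
    tensorCoeff F n (polyAd g h u) =
      ⁅g, tensorCoeff F n ((Polynomial.X : F[X]) • u)⁆ + ⁅h, tensorCoeff F n u⁆ := by
  induction u with
  | zero => simp
  | tmul f w => simp [polyAd_tmul, tensorCoeff_tmul, TensorProduct.smul_tmul']
  | add u v hu hv => simp only [smul_add, map_add, lie_add, hu, hv]; abel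

/-- Splitting the words of length `n + 1` by their last letter. -/
theorem sum_words_succ {M : Type*} [AddCommMonoid M] (n : ℕ) (hn : 2 ≤ n) (f : Finset ℕ → M) :
    ∑ S ∈ (Finset.Icc 1 (n + 1)).powerset with 1 ∈ S ∧ 2 ∉ S, f S =
      ∑ S ∈ (Finset.Icc 1 n).powerset with 1 ∈ S ∧ 2 ∉ S, (f S + f (insert (n + 1) S)) := by
  have h : Finset.Icc 1 (n + 1) = insert (n + 1) (Finset.Icc 1 n) := by
    ext; simp only [Finset.mem_Icc, Finset.mem_insert]; omega
  rw [Finset.sum_filter, Finset.sum_filter, h, Finset.sum_powerset_insert (by simp),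
    ← Finset.sum_add_distrib]
  refine Finset.sum_congr rfl fun S _ => ?_
  have h1 : 1 ≠ n + 1 := by omega
  have h2 : 2 ≠ n + 1 := by omega
  simp only [Finset.mem_insert, h1, h2, false_or]
  split_ifs <;> simp

theorem leftBracket_congr {w w' : ℕ → L} :
    ∀ n : ℕ, (∀ i, 1 ≤ i → i ≤ n → w i = w' i) → leftBracket w n = leftBracket w' n
  | 0, _ => rfl
  | 1, h => h 1 le_rfl le_rfl
  | n + 2, h => by
    rw [leftBracket, leftBracket, h (n + 2) (by omega) le_rfl,
      leftBracket_congr (n + 1) fun i hi hi' => h i hi (by omega)]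

theorem leftBracket_word_insert {S : Finset ℕ} (g h : L) (n : ℕ) :
    leftBracket (word (insert (n + 1) S) g h) n = leftBracket (word S g h) n := by
  refine leftBracket_congr n fun i _ hi => ?_
  have : i ≠ n + 1 := by omega
  simp [word, this]

theorem word_of_notMem {M : Type*} {S : Finset ℕ} (g h : M) {n : ℕ} (hn : n ∉ S) : word S g h n = h := by
  simp [word, hn]

theorem word_of_mem {M : Type*} {S : Finset ℕ} (g h : M) {n : ℕ} (hn : n ∈ S) : word S g h n = g := by
  simp [word, hn]

theorem notMem_of_mem_words {n : ℕ} {S : Finset ℕ}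
    (hS : S ∈ (Finset.Icc 1 n).powerset.filter fun S => 1 ∈ S ∧ 2 ∉ S) : n + 1 ∉ S := by
  intro h
  have := (Finset.mem_Icc.1 (Finset.mem_powerset.1 (Finset.mem_filter.1 hS).1 h)).2
  omega

/-- The generating function of the left-normed brackets of all words in `g` and `h` beginning
with `g`, `h`, by the number of letters `g`. -/
theorem sum_words_leftBracket (g h : L) (n : ℕ) :
    ∑ S ∈ (Finset.Icc 1 (n + 2)).powerset with 1 ∈ S ∧ 2 ∉ S,
        (Polynomial.X ^ S.card : F[X]) ⊗ₜ[F] leftBracket (word S g h) (n + 2) =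
      (Polynomial.X : F[X]) •
        ((-polyAd g h) ^ n) ((1 : F[X]) ⊗ₜ[F] ⁅g, h⁆) := by
  induction n with
  | zero =>
    have : ((Finset.Icc 1 2).powerset.filter fun S : Finset ℕ => 1 ∈ S ∧ 2 ∉ S) = {{1}} := by
      decide
    simp [this, leftBracket, word, TensorProduct.smul_tmul']
  | succ n ih =>
    rw [pow_succ', Module.End.mul_apply, ← map_smul, ← ih, sum_words_succ _ (by omega), map_sum]
    refine Finset.sum_congr rfl fun S hS => ?_
    have hn := notMem_of_mem_words hS
    have hL : ∀ w : ℕ → L, leftBracket w (n + 1 + 2) = ⁅leftBracket w (n + 2), w (n + 2 + 1)⁆ :=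
      fun _ => rfl
    rw [hL, hL, leftBracket_word_insert, Finset.card_insert_of_notMem hn,
      word_of_notMem g h hn, word_of_mem g h (Finset.mem_insert_self _ _), LinearMap.neg_apply,
      polyAd_tmul, ← lie_skew, ← lie_skew _ g, pow_succ']
    simp only [TensorProduct.tmul_neg]
    abel

/-- Grouping the words by `#S` reads off the generating function. Since `1 ∈ S` and `2 ∉ S`, `#S`
lies between `1` and `n + 1`, so any larger cutoff `N` is harmless; the freedom lets this sum share
its range with the next one. -/
theorem sum_words_inv_card (g h : L) (n N : ℕ) (hN : n + 1 ≤ N) (ψ : L →ₗ[F] F) :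
    ∑ S ∈ (Finset.Icc 1 (n + 2)).powerset with 1 ∈ S ∧ 2 ∉ S,
        (S.card : F)⁻¹ * ψ (leftBracket (word S g h) (n + 2)) =
      ∑ i ∈ Finset.Icc 1 N, (i : F)⁻¹ * ψ (tensorCoeff F (i - 1)
        (((-polyAd g h) ^ n) ((1 : F[X]) ⊗ₜ[F] ⁅g, h⁆))) := by
  have key : ∀ i ∈ Finset.Icc 1 N, tensorCoeff F (i - 1)
        (((-polyAd g h) ^ n) ((1 : F[X]) ⊗ₜ[F] ⁅g, h⁆)) =
      ∑ S ∈ (Finset.Icc 1 (n + 2)).powerset with 1 ∈ S ∧ 2 ∉ S,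
        if i = S.card then leftBracket (word S g h) (n + 2) else 0 := by
    intro i hi
    obtain ⟨j, rfl⟩ : ∃ j, i = j + 1 := ⟨i - 1, by have := (Finset.mem_Icc.1 hi).1; omega⟩
    rw [Nat.add_sub_cancel, ← tensorCoeff_X_smul, ← sum_words_leftBracket, map_sum]
    refine Finset.sum_congr rfl fun S _ => ?_
    rw [tensorCoeff_tmul, Polynomial.coeff_X_pow]
    split_ifs <;> simp
  rw [Finset.sum_congr (s₁ := Finset.Icc 1 N) rfl fun i hi => by rw [key i hi]]
  simp_rw [map_sum, Finset.mul_sum]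
  rw [Finset.sum_comm]
  refine Finset.sum_congr rfl fun S hS => ?_
  obtain ⟨hS, h1, h2⟩ := Finset.mem_filter.1 hS
  have hcard : S.card ∈ Finset.Icc 1 N := by
    rw [Finset.mem_Icc]
    refine ⟨Finset.card_pos.2 ⟨1, h1⟩, le_trans (Nat.le_of_lt_succ ?_) hN⟩
    have := Finset.card_lt_card ((Finset.ssubset_iff_of_subset (Finset.mem_powerset.1 hS)).2
      ⟨2, by simp, h2⟩)
    simp only [Nat.card_Icc] at this
    omega
  rw [Finset.sum_eq_single_of_mem _ hcard]
  · simp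
  · intro i _ hi
    simp [hi]

/-- The variant for words that receive one further letter `g`: the weight shifts by one, which is
the extra factor `X`. -/
theorem sum_words_inv_card_add_one (g h : L) (n N : ℕ) (hN : n + 2 ≤ N) (ψ : L →ₗ[F] F) :
    ∑ S ∈ (Finset.Icc 1 (n + 2)).powerset with 1 ∈ S ∧ 2 ∉ S,
        ((S.card + 1 : ℕ) : F)⁻¹ * ψ (leftBracket (word S g h) (n + 2)) =
      ∑ i ∈ Finset.Icc 1 N, (i : F)⁻¹ * ψ (tensorCoeff F (i - 1) ((Polynomial.X : F[X]) •
        ((-polyAd g h) ^ n) ((1 : F[X]) ⊗ₜ[F] ⁅g, h⁆))) := by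
  have key : ∀ i ∈ Finset.Icc 1 N, tensorCoeff F (i - 1) ((Polynomial.X : F[X]) •
        ((-polyAd g h) ^ n) ((1 : F[X]) ⊗ₜ[F] ⁅g, h⁆)) =
      ∑ S ∈ (Finset.Icc 1 (n + 2)).powerset with 1 ∈ S ∧ 2 ∉ S,
        if i = S.card + 1 then leftBracket (word S g h) (n + 2) else 0 := by
    intro i hi
    have := (Finset.mem_Icc.1 hi).1
    rw [← sum_words_leftBracket, map_sum]
    refine Finset.sum_congr rfl fun S _ => ?_
    rw [tensorCoeff_tmul, Polynomial.coeff_X_pow]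
    have : i - 1 = S.card ↔ i = S.card + 1 := by omega
    simp only [this]
    split_ifs <;> simp
  rw [Finset.sum_congr (s₁ := Finset.Icc 1 N) rfl fun i hi => by rw [key i hi]]
  simp_rw [map_sum, Finset.mul_sum]
  rw [Finset.sum_comm]
  refine Finset.sum_congr rfl fun S hS => ?_
  obtain ⟨hS, h1, h2⟩ := Finset.mem_filter.1 hS
  have hcard : S.card + 1 ∈ Finset.Icc 1 N := by
    have := Finset.card_lt_card ((Finset.ssubset_iff_of_subset (Finset.mem_powerset.1 hS)).2
      ⟨2, by simp, h2⟩)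
    simp only [Nat.card_Icc] at this
    rw [Finset.mem_Icc]
    omega
  rw [Finset.sum_eq_single_of_mem _ hcard]
  · simp
  · intro i _ hi
    simp [hi]

theorem cochain2_add_left (φ : Cochain2 F L) (x x' y : L) :
    φ ![x + x', y] = φ ![x, y] + φ ![x', y] :=
  φ.toMultilinearMap.cons_add ![y] x x'

theorem cochain2_smul_left (φ : Cochain2 F L) (a : F) (x y : L) :
    φ ![a • x, y] = a * φ ![x, y] :=
  φ.toMultilinearMap.cons_smul ![y] a x

theorem cochain2_self (φ : Cochain2 F L) (x : L) : φ ![x, x] = 0 :=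
  φ.map_eq_zero_of_eq ![x, x] (i := 0) (j := 1) rfl (by decide)

theorem cochain2_swap (φ : Cochain2 F L) (x y : L) : φ ![x, y] = -φ ![y, x] := by
  rw [← φ.map_swap ![y, x] (i := 0) (j := 1) (by decide)]
  congr 1
  ext i
  fin_cases i <;> rfl

theorem cochain2_add_right (φ : Cochain2 F L) (x y y' : L) :
    φ ![x, y + y'] = φ ![x, y] + φ ![x, y'] := by
  rw [cochain2_swap, cochain2_add_left, cochain2_swap φ x, cochain2_swap φ x]; ring

theorem cochain2_smul_right (φ : Cochain2 F L) (a : F) (x y : L) :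
    φ ![x, a • y] = a * φ ![x, y] := by
  rw [cochain2_swap, cochain2_smul_left, cochain2_swap φ x]; ring

/-- The bilinear form `(x, y) ↦ φ (x ∧ y)`. -/
def Cochain2.bilin (φ : Cochain2 F L) : L →ₗ[F] L →ₗ[F] F :=
  LinearMap.mk₂ F (fun x y => φ ![x, y]) (cochain2_add_left φ) (cochain2_smul_left φ)
    (cochain2_add_right φ) (cochain2_smul_right φ)

theorem Cochain2.bilin_apply (φ : Cochain2 F L) (x y : L) : φ.bilin x y = φ ![x, y] := rfl

/-- The sum over words, through the operator `ad (X ⊗ g + 1 ⊗ h)` on `F[X] ⊗ L`. -/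
theorem compatSum_eq (hp : 2 < p) (hodd : Odd p) (φ : Cochain2 F L) (g h : L) :
    compatSum p φ g h = ∑ i ∈ Finset.Icc 1 (p - 1), (i : F)⁻¹ *
      (φ ![tensorCoeff F (i - 1) ((polyAd g h ^ (p - 3)) ((1 : F[X]) ⊗ₜ[F] ⁅g, h⁆)), h] +
      φ ![tensorCoeff F (i - 1) ((Polynomial.X : F[X]) •
        (polyAd g h ^ (p - 3)) ((1 : F[X]) ⊗ₜ[F] ⁅g, h⁆)), g]) := by
  obtain ⟨k, hk⟩ := hodd
  -- The exponent `p - 3` is even, so the sign of `-ad` disappears.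
  rw [show p - 3 = k - 1 + (k - 1) by omega, ← neg_polyAd_pow_even,
    show k - 1 + (k - 1) = p - 3 by omega]
  clear hk k
  obtain ⟨n, rfl⟩ : ∃ n, p = n + 2 + 1 := ⟨p - 3, by omega⟩
  -- The words split by their last letter: `h` leaves the number of letters `g` unchanged, `g`
  -- raises it by one.
  have h1 := sum_words_inv_card g h n (n + 2) (by omega) (φ.bilin.flip h)
  have h2 := sum_words_inv_card_add_one g h n (n + 2) (by omega) (φ.bilin.flip g)
  simp only [LinearMap.flip_apply, Cochain2.bilin_apply] at h1 h2
  simp only [mul_add, Finset.sum_add_distrib]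
  rw [show n + 2 + 1 - 1 = n + 2 by omega, show n + 2 + 1 - 3 = n by omega, ← h1, ← h2, compatSum,
    sum_words_succ _ (by omega), ← Finset.sum_add_distrib]
  refine Finset.sum_congr rfl fun S hS => ?_
  have hn := notMem_of_mem_words hS
  rw [Nat.add_sub_cancel, leftBracket_word_insert, word_of_notMem g h hn,
    word_of_mem g h (Finset.mem_insert_self _ _), Finset.card_insert_of_notMem hn]

theorem d1_apply (ψ : Module.Dual F L) (g h : L) : d1 ψ ![g, h] = ψ ⁅g, h⁆ := rfl

/-- For a coboundary the sum over words is Jacobson's polynomial. -/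
theorem compatSum_d1 (hp : 2 < p) (hodd : Odd p) (ψ : Module.Dual F L) (g h : L) :
    compatSum p (d1 ψ) g h = ψ (∑ i ∈ Finset.Icc 1 (p - 1), jacobsonTerm F p i g h) := by
  rw [compatSum_eq hp hodd, map_sum]
  refine Finset.sum_congr rfl fun i _ => ?_
  -- The innermost of the `p - 1` adjoints sends `g` to `⁅h, g⁆`; the outermost supplies the last
  -- letter of the word.
  rw [jacobsonTerm, map_smul ψ, smul_eq_mul, d1_apply, d1_apply, ← map_add ψ, ← polyAd,
    show p - 1 = p - 3 + 1 + 1 by omega, pow_succ, pow_succ', Module.End.mul_apply,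
    Module.End.mul_apply, polyAd_tmul, lie_self, TensorProduct.tmul_zero, zero_add,
    tensorCoeff_polyAd, ← lie_skew h g, TensorProduct.tmul_neg, map_neg, smul_neg, map_neg,
    map_neg, lie_neg, lie_neg, lie_skew, lie_skew, add_comm]

theorem isCompatible_d1 (hp : 2 < p) (hodd : Odd p) (P : RestrictedStructure F p L)
    (ψ : Module.Dual F L) : IsCompatible p (d1 ψ) fun g => ψ (P.pow g) := by
  refine ⟨fun a g => ?_, fun g h => ?_⟩
  · simp [P.pow_smul]
  · simp only [P.pow_add, map_add, compatSum_d1 hp hodd]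

theorem IsCompatible.add {φ φ' : Cochain2 F L} {ω ω' : L → F} (h : IsCompatible p φ ω)
    (h' : IsCompatible p φ' ω') : IsCompatible p (φ + φ') (ω + ω') :=
  (restrictedCochain2 F p L).add_mem (x := CochainPair.mk φ ω) (y := CochainPair.mk φ' ω') h h'

theorem IsCompatible.smul (a : F) {φ : Cochain2 F L} {ω : L → F} (h : IsCompatible p φ ω) :
    IsCompatible p (a • φ) (a • ω) :=
  (restrictedCochain2 F p L).smul_mem (x := CochainPair.mk φ ω) a h

/-- Evaluation at `1` of a polynomial of degree at most `p`, through its derivative. -/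
theorem Polynomial.eval_one_eq_of_natDegree_le [CharP F p] (hp : 1 < p) (f : F[X])
    (hf : f.natDegree ≤ p) :
    f.eval 1 = f.coeff p + f.coeff 0 +
      ∑ i ∈ Finset.Icc 1 (p - 1), (i : F)⁻¹ * (Polynomial.derivative f).coeff (i - 1) := by
  have h : ∀ i ∈ Finset.Icc 1 (p - 1),
      -- Valid only because `0 < i < p`; the derivative does not see the coefficients of index `0`
      -- and `p`, which stay as separate terms.
      (i : F)⁻¹ * (Polynomial.derivative f).coeff (i - 1) = f.coeff i := by
    intro i hi
    obtain ⟨h1, h2⟩ := Finset.mem_Icc.1 hi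
    have hi0 : (i : F) ≠ 0 := by
      rw [Ne, CharP.cast_eq_zero_iff F p]
      exact fun h => absurd (Nat.le_of_dvd h1 h) (by omega)
    obtain ⟨j, rfl⟩ : ∃ j, i = j + 1 := ⟨i - 1, by omega⟩
    rw [Polynomial.coeff_derivative]
    rw [Nat.add_sub_cancel]
    push_cast at hi0 ⊢
    field_simp
  rw [Finset.sum_congr rfl h, Polynomial.eval_eq_sum_range' (Nat.lt_succ_of_le hf)]
  simp only [one_pow, mul_one]
  rw [Nat.succ_eq_add_one, Finset.sum_range_succ, Finset.range_eq_Ico,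
    Finset.sum_eq_sum_Ico_succ_bot (by omega)]
  have : Finset.Ico (0 + 1) p = Finset.Icc 1 (p - 1) := by
    ext; simp only [Finset.mem_Ico, Finset.mem_Icc]; omega
  rw [this]
  ring

end General

namespace TwistedHeisenberg

/-! ### Coordinates on the twisted Heisenberg algebra and determination by basis values. -/

variable {F : Type*} [Field F] {p m : ℕ} {lam : Fin m → F}

/-- The coordinate `g ↦ g k`, as a linear form. -/
def coord (lam : Fin m → F) (k : HIdx m) : Module.Dual F (TwistedHeisenberg lam) where
  toFun g := g k
  map_add' _ _ := rfl
  map_smul' _ _ := rfl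

theorem coord_apply (k : HIdx m) (g : TwistedHeisenberg lam) : coord lam k g = g k := rfl

theorem sub_apply (g h : TwistedHeisenberg lam) (k : HIdx m) : (g - h) k = g k - h k := rfl

theorem e_apply (k l : HIdx m) : e lam k l = if l = k then 1 else 0 := rfl

theorem eq_sum_e (g : TwistedHeisenberg lam) :
    g = ∑ i, (g (.x i) • e lam (.x i) + g (.y i) • e lam (.y i)) + g .z • e lam .z +
      g .t • e lam .t := by
  ext k
  rw [← coord_apply (lam := lam) k g, ← coord_apply (lam := lam) k (_ + _), map_add, map_add,
    map_sum]
  cases k <;> simp [coord_apply, add_apply, smul_apply, e_apply]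

theorem addMonoidHom_eq_zero {M : Type*} [AddCommGroup M] (δ : TwistedHeisenberg lam →+ M)
    (h : ∀ (a : F) (k : HIdx m), δ (a • e lam k) = 0) : δ = 0 := by
  ext g
  rw [eq_sum_e g]
  simp [map_sum, h]

theorem linearMap_eq_zero {M : Type*} [AddCommGroup M] [Module F M]
    (δ : TwistedHeisenberg lam →ₗ[F] M) (h : ∀ k : HIdx m, δ (e lam k) = 0) (g) : δ g = 0 :=
  DFunLike.congr_fun (addMonoidHom_eq_zero δ.toAddMonoidHom fun a k => by simp [h]) g

theorem cochain2_ext {φ φ' : Cochain2 F (TwistedHeisenberg lam)}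
    (h : ∀ k l, φ ![e lam k, e lam l] = φ' ![e lam k, e lam l]) : φ = φ' := by
  ext v
  have hv : v = ![v 0, v 1] := by ext i; fin_cases i <;> rfl
  rw [hv, ← sub_eq_zero, ← AlternatingMap.sub_apply, ← Cochain2.bilin_apply]
  have : (φ - φ').bilin (v 0) = 0 := by
    refine linearMap_eq_zero _ (fun k => ?_) (v 0)
    ext g
    refine linearMap_eq_zero _ (fun l => ?_) g
    rw [Cochain2.bilin_apply, AlternatingMap.sub_apply, h, sub_self]
  rw [this, LinearMap.zero_apply]

/-- The correction term depends on `φ` alone, so it cancels in `ω - ω'`, which is then additive and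
vanishes on all multiples of basis vectors. -/
theorem isCompatible_ext {φ : Cochain2 F (TwistedHeisenberg lam)} (hp : p ≠ 0)
    {ω ω' : TwistedHeisenberg lam → F} (h : IsCompatible p φ ω) (h' : IsCompatible p φ ω')
    (he : ∀ k, ω (e lam k) = ω' (e lam k)) : ω = ω' := by
  have := addMonoidHom_eq_zero (lam := lam) (M := F)
    { toFun := fun g => ω g - ω' g
      map_zero' := by
        have h1 := h.1 0 0
        have h2 := h'.1 0 0
        rw [zero_smul, zero_pow hp, zero_mul] at h1 h2
        rw [h1, h2, sub_self]
      map_add' := fun g k => by rw [h.2, h'.2]; ring } fun a k => by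
        simp [h.1, h'.1, he]
  funext g
  exact sub_eq_zero.1 (DFunLike.congr_fun this g)

theorem lie_e_z (g : TwistedHeisenberg lam) : ⁅g, e lam .z⁆ = 0 := by
  ext (i | i | _ | _) <;> simp [lie_x, lie_y, lie_z, lie_t, e_apply, zero_apply]

/-! ### Iterated brackets modulo the centre and closed forms of compatible maps. -/

theorem lie_eq_of_t_eq_zero (g : TwistedHeisenberg lam) {w : TwistedHeisenberg lam}
    (hw : w .t = 0) : ⁅g, w⁆ = g .t • ⁅e lam .t, w⁆ + ⁅g, w⁆ .z • e lam .z := by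
  ext (i | i | _ | _) <;>
    simp [lie_x, lie_y, lie_z, lie_t, e_apply, add_apply, smul_apply, hw] <;> ring

theorem ad_pow_t_eq_zero (g : TwistedHeisenberg lam) {w : TwistedHeisenberg lam} (hw : w .t = 0)
    (n : ℕ) : ((LieAlgebra.ad F _ g ^ n) w) .t = 0 := by
  cases n with
  | zero => exact hw
  | succ n => rw [pow_succ', Module.End.mul_apply, LieAlgebra.ad_apply, lie_t]

theorem ad_pow_even_x (g : TwistedHeisenberg lam) {w : TwistedHeisenberg lam} (hw : w .t = 0)
    (n : ℕ) (i : Fin m) :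
    ((LieAlgebra.ad F _ g ^ (2 * n)) w) (.x i) = (lam i * g .t) ^ (2 * n) * w (.x i) := by
  induction n with
  | zero => simp
  | succ n ih =>
    rw [show 2 * (n + 1) = 2 * n + 1 + 1 by ring, pow_succ', pow_succ', Module.End.mul_apply,
      Module.End.mul_apply, LieAlgebra.ad_apply, LieAlgebra.ad_apply, lie_x, lie_y, lie_t, ih,
      ad_pow_t_eq_zero g hw]
    ring

theorem ad_pow_even_y (g : TwistedHeisenberg lam) {w : TwistedHeisenberg lam} (hw : w .t = 0)
    (n : ℕ) (i : Fin m) :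
    ((LieAlgebra.ad F _ g ^ (2 * n)) w) (.y i) = (lam i * g .t) ^ (2 * n) * w (.y i) := by
  induction n with
  | zero => simp
  | succ n ih =>
    rw [show 2 * (n + 1) = 2 * n + 1 + 1 by ring, pow_succ', pow_succ', Module.End.mul_apply,
      Module.End.mul_apply, LieAlgebra.ad_apply, LieAlgebra.ad_apply, lie_y, lie_x, lie_t, ih,
      ad_pow_t_eq_zero g hw]
    ring

/-- The polynomial `t`-coordinate of `X ⊗ g + 1 ⊗ h`. -/
noncomputable def tPoly (g h : TwistedHeisenberg lam) : F[X] :=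
  Polynomial.C (g .t) * Polynomial.X + Polynomial.C (h .t)

/-- Modulo `e_z` only the `t`-component of `X g + h` acts on `w`, and brackets with `e_z` vanish, so
the error never propagates beyond a multiple of `e_z`. -/
theorem polyAd_pow_tmul (g h : TwistedHeisenberg lam) {w : TwistedHeisenberg lam}
    (hw : w .t = 0) (n : ℕ) : ∃ s : F[X], (polyAd g h ^ n) ((1 : F[X]) ⊗ₜ[F] w) =
      (tPoly g h ^ n) ⊗ₜ[F] ((LieAlgebra.ad F _ (e lam .t) ^ n) w) + s ⊗ₜ[F] e lam .z := by
  induction n with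
  | zero => exact ⟨0, by simp⟩
  | succ n ih =>
    obtain ⟨s, hs⟩ := ih
    have hw' := ad_pow_t_eq_zero (e lam .t) hw n
    rw [pow_succ', Module.End.mul_apply, hs, map_add, polyAd_tmul, polyAd_tmul, lie_e_z, lie_e_z,
      lie_eq_of_t_eq_zero g hw', lie_eq_of_t_eq_zero h hw', pow_succ' (LieAlgebra.ad F _ _),
      Module.End.mul_apply, LieAlgebra.ad_apply]
    set w' := (LieAlgebra.ad F _ (e lam .t) ^ n) w
    refine ⟨⁅g, w'⁆ .z • (Polynomial.X * tPoly g h ^ n) + ⁅h, w'⁆ .z • tPoly g h ^ n, ?_⟩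
    have : tPoly g h ^ (n + 1) =
        g .t • (Polynomial.X * tPoly g h ^ n) + h .t • tPoly g h ^ n := by
      rw [pow_succ', tPoly, Polynomial.smul_eq_C_mul, Polynomial.smul_eq_C_mul]; ring
    rw [this]
    simp only [TensorProduct.tmul_add, TensorProduct.add_tmul, TensorProduct.tmul_smul,
      TensorProduct.smul_tmul', TensorProduct.tmul_zero]
    abel

/-- The operator `(ad e_t) ^ (p - 2)` on the span of the `x i` and `y i`, extended by zero. -/
def twist (p : ℕ) (lam : Fin m → F) : TwistedHeisenberg lam →ₗ[F] TwistedHeisenberg lam where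
  toFun g
    | .x i => lam i ^ (p - 2) * g (.y i)
    | .y i => lam i ^ (p - 2) * g (.x i)
    | .z => 0
    | .t => 0
  map_add' g h := by
    ext (_ | _ | _ | _)
    exacts [mul_add _ _ _, mul_add _ _ _, (add_zero 0).symm, (add_zero 0).symm]
  map_smul' a g := by
    ext (_ | _ | _ | _)
    exacts [mul_left_comm _ _ _, mul_left_comm _ _ _, (mul_zero a).symm, (mul_zero a).symm]

theorem twist_x (g : TwistedHeisenberg lam) (i : Fin m) :
    twist p lam g (.x i) = lam i ^ (p - 2) * g (.y i) := rfl

theorem twist_y (g : TwistedHeisenberg lam) (i : Fin m) :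
    twist p lam g (.y i) = lam i ^ (p - 2) * g (.x i) := rfl

theorem twist_z (g : TwistedHeisenberg lam) : twist p lam g .z = 0 := rfl

theorem twist_t (g : TwistedHeisenberg lam) : twist p lam g .t = 0 := rfl

theorem ad_e_t_pow_lie (hp : 2 < p) (hodd : Odd p) (g h : TwistedHeisenberg lam) :
    ∃ b : F, (LieAlgebra.ad F _ (e lam .t) ^ (p - 3)) ⁅g, h⁆ =
      twist p lam (g .t • h - h .t • g) + b • e lam .z := by
  obtain ⟨k, hk⟩ := hodd
  have h3 : p - 3 = 2 * (k - 1) := by omega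
  have h2 : p - 2 = 2 * (k - 1) + 1 := by omega
  -- This central term can be nonzero only for `p = 3`, where no adjoint is applied.
  refine ⟨((LieAlgebra.ad F _ (e lam .t) ^ (p - 3)) ⁅g, h⁆) .z, ?_⟩
  ext (i | i | _ | _)
  · rw [h3, ad_pow_even_x _ (lie_t g h)]
    simp [lie_x, twist_x, add_apply, smul_apply, sub_apply, e_apply, h2]
    ring
  · rw [h3, ad_pow_even_y _ (lie_t g h)]
    simp [lie_y, twist_y, add_apply, smul_apply, sub_apply, e_apply, h2]
    ring
  · rw [add_apply, twist_z]; simp [smul_apply, e_apply]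
  · rw [ad_pow_t_eq_zero _ (lie_t g h)]
    rw [add_apply, twist_t]; simp [smul_apply, e_apply]

theorem compatSum_eq_of_z (hp : 2 < p) (hodd : Odd p) {φ : Cochain2 F (TwistedHeisenberg lam)}
    (hz : ∀ g, φ ![e lam .z, g] = 0) (g h : TwistedHeisenberg lam) :
    compatSum p φ g h = ∑ i ∈ Finset.Icc 1 (p - 1), (i : F)⁻¹ *
      (tPoly g h ^ (p - 3) *
        (Polynomial.C (φ ![twist p lam (g .t • h - h .t • g), g]) * Polynomial.X +
          Polynomial.C (φ ![twist p lam (g .t • h - h .t • g), h]))).coeff (i - 1) := by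
  rw [compatSum_eq hp hodd]
  refine Finset.sum_congr rfl fun i _ => ?_
  congr 1
  obtain ⟨s, hs⟩ := polyAd_pow_tmul g h (lie_t g h) (p - 3)
  obtain ⟨b, hb⟩ := ad_e_t_pow_lie hp hodd g h
  rw [hs, hb]
  simp only [smul_add, map_add, TensorProduct.smul_tmul', tensorCoeff_tmul, cochain2_add_left,
    cochain2_smul_left, hz, mul_zero, add_zero, smul_eq_mul, mul_add, Polynomial.coeff_add,
    Polynomial.coeff_mul_C, ← mul_assoc]
  rw [mul_comm (_ ^ _) (Polynomial.C _), mul_assoc (Polynomial.C _), Polynomial.coeff_C_mul,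
    mul_comm Polynomial.X]
  ring

theorem natDegree_tPoly_le (g h : TwistedHeisenberg lam) : (tPoly g h).natDegree ≤ 1 := by
  unfold tPoly; compute_degree

theorem derivative_tPoly (g h : TwistedHeisenberg lam) :
    Polynomial.derivative (tPoly g h) = Polynomial.C (g .t) := by
  simp [tPoly]

/-- A polynomial primitive evaluates the sum over words. -/
theorem compatSum_eq_of_derivative [CharP F p] (hp : 2 < p) (hodd : Odd p)
    {φ : Cochain2 F (TwistedHeisenberg lam)} (hz : ∀ g, φ ![e lam .z, g] = 0)
    (g h : TwistedHeisenberg lam) (n k : ℕ) (hnk : n + k = p) (r : F[X]) (hr : r.natDegree ≤ k)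
    (hd : Polynomial.derivative (tPoly g h ^ n * r) = tPoly g h ^ (p - 3) *
        (Polynomial.C (φ ![twist p lam (g .t • h - h .t • g), g]) * Polynomial.X +
          Polynomial.C (φ ![twist p lam (g .t • h - h .t • g), h]))) :
    (g + h) .t ^ n * r.eval 1 =
      g .t ^ n * r.coeff k + h .t ^ n * r.coeff 0 + compatSum p φ g h := by
  have hn : (tPoly g h ^ n).natDegree ≤ n := by
    simpa using Polynomial.natDegree_pow_le_of_le n (natDegree_tPoly_le g h)
  have h1 := Polynomial.eval_one_eq_of_natDegree_le (p := p) (by omega) (tPoly g h ^ n * r)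
    (hnk ▸ Polynomial.natDegree_mul_le_of_le hn hr)
  rw [compatSum_eq_of_z hp hodd hz, ← hd]
  rw [← hnk, Polynomial.coeff_mul_add_eq_of_natDegree_le hn hr] at h1
  have h2 : (tPoly g h ^ n).coeff n = g .t ^ n := by
    have := Polynomial.coeff_pow_of_natDegree_le (m := n) (natDegree_tPoly_le g h)
    rw [mul_one] at this
    rw [this]
    simp [tPoly]
  rw [h2, Polynomial.mul_coeff_zero, Polynomial.coeff_zero_eq_eval_zero (tPoly g h ^ n),
    Polynomial.eval_mul, Polynomial.eval_pow, Polynomial.eval_pow, hnk] at h1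
  simpa [tPoly, add_apply] using h1

/-- The compatible map attached to a form for which `twist` is symmetric. -/
theorem isCompatible_twist [CharP F p] (hp : 2 < p) (hodd : Odd p)
    {φ : Cochain2 F (TwistedHeisenberg lam)} (hz : ∀ g, φ ![e lam .z, g] = 0)
    (hs : ∀ g h, φ ![twist p lam g, h] = φ ![twist p lam h, g]) :
    IsCompatible p φ fun g => g .t ^ (p - 2) * (-(2 : F)⁻¹ * φ ![twist p lam g, g]) := by
  have h2 : (2 : F) ≠ 0 := by
    have := CharP.cast_eq_zero_iff F p 2
    intro h
    exact absurd (Nat.le_of_dvd two_pos (this.1 (by exact_mod_cast h))) (by omega)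
  have hp2 : ((p - 2 : ℕ) : F) = -2 := by
    rw [Nat.cast_sub hp.le, CharP.cast_eq_zero]; simp
  refine ⟨fun a g => ?_, fun g h => ?_⟩
  · obtain ⟨q, rfl⟩ : ∃ q, p = q + 2 := ⟨p - 2, by omega⟩
    simp only [map_smul, cochain2_smul_left, cochain2_smul_right, smul_apply, mul_pow, pow_add,
      Nat.add_sub_cancel]
    ring
  · have key := compatSum_eq_of_derivative hp hodd hz g h (p - 2) 2 (by omega)
      -- This is `-q(X g + h) / 2` for the quadratic form `q(v) = φ(twist v, v)`, expanded by the
      -- symmetry `hs`. As `p - 2 = -2` in `F`, the terms in `X ^ 2` cancel in the derivative of its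
      -- product with `T ^ (p - 2)`.
      (Polynomial.C (-(2 : F)⁻¹) * (Polynomial.C (φ ![twist p lam g, g]) * Polynomial.X ^ 2 +
        Polynomial.C (2 * φ ![twist p lam g, h]) * Polynomial.X +
          Polynomial.C (φ ![twist p lam h, h]))) (by compute_degree) ?_
    · simp only [map_add, cochain2_add_left, cochain2_add_right]
      simp [Polynomial.coeff_X, Polynomial.coeff_C] at key
      rw [hs h g]
      linear_combination key
    · have hd : Polynomial.derivative (tPoly g h ^ (p - 2)) =
          -2 * Polynomial.C (g .t) * tPoly g h ^ (p - 3) := by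
        rw [Polynomial.derivative_pow, derivative_tPoly, hp2, show p - 2 - 1 = p - 3 by omega]
        rw [Polynomial.C_neg, show (Polynomial.C 2 : F[X]) = 2 from rfl]; ring
      have e2 : Polynomial.C (2⁻¹ : F) * 2 = 1 := by
        rw [show (2 : F[X]) = Polynomial.C 2 from rfl, ← Polynomial.C_mul, inv_mul_cancel₀ h2,
          Polynomial.C_1]
      have ht : tPoly g h ^ (p - 2) = tPoly g h ^ (p - 3) * tPoly g h := by
        rw [← pow_succ]; congr 1; omega
      have hl : ∀ k, φ ![twist p lam (g .t • h - h .t • g), k] =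
          g .t * φ ![twist p lam h, k] - h .t * φ ![twist p lam g, k] := fun k => by
        rw [sub_eq_add_neg, ← neg_smul, map_add, map_smul, map_smul, cochain2_add_left,
          cochain2_smul_left, cochain2_smul_left]
        ring
      rw [Polynomial.derivative_mul, hd, ht, hl, hl, hs h g]
      simp only [tPoly, Polynomial.derivative_neg, Polynomial.derivative_mul, Polynomial.derivative_add,
        Polynomial.derivative_C, Polynomial.derivative_X, Polynomial.derivative_X_pow,
        Polynomial.C_sub, Polynomial.C_mul, Polynomial.C_neg]
      simp only [show (Polynomial.C (2 : F)) = 2 from rfl, Nat.cast_ofNat]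
      generalize (Polynomial.C (g .t) * Polynomial.X + Polynomial.C (h .t)) ^ (p - 3) = τ
      generalize Polynomial.C (φ ![twist p lam g, g]) = A
      generalize Polynomial.C (φ ![twist p lam g, h]) = B
      generalize Polynomial.C (φ ![twist p lam h, h]) = D
      generalize Polynomial.C (g .t) = a at *
      generalize Polynomial.C (h .t) = b at *
      generalize Polynomial.C (2⁻¹ : F) = k2 at *
      simp
      linear_combination
        (a * τ * Polynomial.X * B + a * τ * D - τ * A * Polynomial.X * b - τ * B * b) * e2

theorem lie_e_z_left (g : TwistedHeisenberg lam) : ⁅e lam .z, g⁆ = 0 := by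
  rw [← lie_skew, lie_e_z, neg_zero]

theorem d1_e_z (ψ : Module.Dual F (TwistedHeisenberg lam)) (g : TwistedHeisenberg lam) :
    d1 ψ ![e lam .z, g] = 0 := by
  rw [d1_apply, lie_e_z_left, map_zero]

/-- Serves the differentials of the `x` and `y` coordinates. The primitive is `T ^ (p - 1)` times
`c` times the `k`-coordinate of `X g + h`, with `p - 1 = -1` in `F`. -/
theorem isCompatible_d1_coord_aux [CharP F p] (hp : 2 < p) (hodd : Odd p) (c : F)
    {φ : Cochain2 F (TwistedHeisenberg lam)} (hz : ∀ g, φ ![e lam .z, g] = 0) (k : HIdx m)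
    (hφ : ∀ g h, φ ![twist p lam g, h] = -(c * h .t * g k)) :
    IsCompatible p φ fun g => g .t ^ (p - 1) * (c * g k) := by
  refine ⟨fun a g => ?_, fun g h => ?_⟩
  · obtain ⟨q, rfl⟩ : ∃ q, p = q + 1 := ⟨p - 1, by omega⟩
    simp only [smul_apply, mul_pow, pow_succ, Nat.add_sub_cancel]
    ring
  · have key := compatSum_eq_of_derivative hp hodd hz g h (p - 1) 1 (by omega)
      (Polynomial.C c * (Polynomial.C (g k) * Polynomial.X + Polynomial.C (h k)))
      (by compute_degree) ?_
    · simp [Polynomial.coeff_X, Polynomial.coeff_C] at key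
      simp only [add_apply] at key ⊢
      linear_combination key
    · have hp1 : ((p - 1 : ℕ) : F) = -1 := by
        rw [Nat.cast_sub (by omega), CharP.cast_eq_zero]; simp
      have hd : Polynomial.derivative (tPoly g h ^ (p - 1)) =
          -Polynomial.C (g .t) * (tPoly g h ^ (p - 3) * tPoly g h) := by
        rw [Polynomial.derivative_pow, derivative_tPoly, hp1, show p - 1 - 1 = p - 3 + 1 by omega,
          pow_succ, Polynomial.C_neg, Polynomial.C_1]
        ring
      have ht : tPoly g h ^ (p - 1) = tPoly g h ^ (p - 3) * tPoly g h * tPoly g h := by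
        rw [← pow_succ, ← pow_succ]; congr 1; omega
      rw [Polynomial.derivative_mul, hd, ht, hφ, hφ]
      simp only [sub_apply, smul_apply]
      simp [tPoly]
      ring

theorem isCompatible_coord_x [CharP F p] (hp : 2 < p) (hodd : Odd p) {c : F} (i : Fin m)
    (hc : lam i ^ (p - 1) = c) :
    IsCompatible p (d1 (coord lam (.x i))) fun g => g .t ^ (p - 1) * (c * g (.x i)) := by
  refine isCompatible_d1_coord_aux hp hodd c (d1_e_z _) _ fun g h => ?_
  rw [d1_apply, coord_apply, lie_x, twist_t, twist_y, ← hc, show p - 1 = p - 2 + 1 by omega]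
  ring

theorem isCompatible_coord_y [CharP F p] (hp : 2 < p) (hodd : Odd p) {c : F} (i : Fin m)
    (hc : lam i ^ (p - 1) = c) :
    IsCompatible p (d1 (coord lam (.y i))) fun g => g .t ^ (p - 1) * (c * g (.y i)) := by
  refine isCompatible_d1_coord_aux hp hodd c (d1_e_z _) _ fun g h => ?_
  rw [d1_apply, coord_apply, lie_y, twist_t, twist_x, ← hc, show p - 1 = p - 2 + 1 by omega]
  ring

theorem isCompatible_eBar [CharP F p] [Fact p.Prime] (k : HIdx m) :
    IsCompatible p (0 : Cochain2 F (TwistedHeisenberg lam)) (eBar p lam k) := by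
  refine ⟨fun a g => ?_, fun g h => ?_⟩
  · simp [eBar, smul_apply, mul_pow]
  · simp [eBar, add_apply, add_pow_char, compatSum]

/-! ### The restricted structures. -/

/-- The Frobenius-semilinear form `∑ k, a_k e_k ↦ ∑ k, μ_k a_k ^ p`. -/
def frobForm (p : ℕ) (lam : Fin m → F) (μ : HIdx m → F) (g : TwistedHeisenberg lam) : F :=
  ∑ i, (μ (.x i) * g (.x i) ^ p + μ (.y i) * g (.y i) ^ p) + μ .z * g .z ^ p + μ .t * g .t ^ p

theorem isCompatible_frobForm [CharP F p] [Fact p.Prime] (μ : HIdx m → F) :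
    IsCompatible p (0 : Cochain2 F (TwistedHeisenberg lam)) (frobForm p lam μ) := by
  refine ⟨fun a g => ?_, fun g h => ?_⟩
  · simp only [frobForm, smul_apply, mul_pow, mul_add, Finset.mul_sum, mul_left_comm]
  · simp only [frobForm, add_apply, add_pow_char, compatSum, AlternatingMap.zero_apply, mul_zero,
      Finset.sum_const_zero, mul_add, Finset.sum_add_distrib]
    ring

theorem d1_coord_z_twist (g h : TwistedHeisenberg lam) :
    d1 (coord lam .z) ![twist p lam g, h] =
      ∑ i, lam i ^ (p - 2) * (g (.y i) * h (.y i) - g (.x i) * h (.x i)) := by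
  rw [d1_apply, coord_apply, lie_z]
  exact Finset.sum_congr rfl fun i _ => by rw [twist_x, twist_y]; ring

/-- The `[p]`-operator with parameters `μ`. -/
noncomputable def stdPow (p : ℕ) (lam : Fin m → F) (c : F) (μ : HIdx m → F)
    (g : TwistedHeisenberg lam) : TwistedHeisenberg lam
  | .x i => g .t ^ (p - 1) * (c * g (.x i))
  | .y i => g .t ^ (p - 1) * (c * g (.y i))
  | .z => g .t ^ (p - 2) * (-(2 : F)⁻¹ * d1 (coord lam .z) ![twist p lam g, g]) +
      frobForm p lam μ g
  | .t => c * g .t ^ p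

/-- By `compatSum_d1` this gives, one coordinate at a time, the additivity axiom of a
`[p]`-operator. The parameters `μ` enter through `frobForm`, which is compatible with the zero
cochain. -/
theorem isCompatible_stdPow [CharP F p] [Fact p.Prime] (hp : 2 < p) (hodd : Odd p) {c : F}
    (hc : ∀ i, lam i ^ (p - 1) = c) (μ : HIdx m → F) (k : HIdx m) :
    IsCompatible p (d1 (coord lam k)) fun g => stdPow p lam c μ g k := by
  cases k with
  | x i => exact isCompatible_coord_x hp hodd i (hc i)
  | y i => exact isCompatible_coord_y hp hodd i (hc i)
  | z =>
    have h := IsCompatible.add (isCompatible_twist hp hodd (d1_e_z (coord lam .z)) fun g h => by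
      rw [d1_coord_z_twist, d1_coord_z_twist]
      exact Finset.sum_congr rfl fun i _ => by ring) (isCompatible_frobForm μ)
    rwa [add_zero] at h
  | t =>
    have h := IsCompatible.smul c (isCompatible_eBar (F := F) (lam := lam) (p := p) .t)
    have h0 : d1 (coord lam .t) = 0 :=
      cochain2_ext fun k l => by rw [d1_apply, coord_apply, lie_t]; rfl
    rw [h0]
    rwa [smul_zero] at h

theorem ad_pow_sub_one_x (hp : 2 < p) (hodd : Odd p) {c : F} (hc : ∀ i, lam i ^ (p - 1) = c)
    (g k : TwistedHeisenberg lam) (i : Fin m) :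
    ((LieAlgebra.ad F _ g ^ (p - 1)) k) (.x i) =
      c * g .t ^ (p - 2) * (g .t * k (.x i) - k .t * g (.x i)) := by
  obtain ⟨q, hq⟩ := hodd
  rw [← hc i, show p - 1 = 2 * (q - 1) + 1 + 1 by omega, show p - 2 = 2 * (q - 1) + 1 by omega,
    pow_succ, pow_succ, Module.End.mul_apply, Module.End.mul_apply, LieAlgebra.ad_apply,
    LieAlgebra.ad_apply, ad_pow_even_x g (lie_t _ _), lie_x, lie_y, lie_t]
  ring

theorem ad_pow_sub_one_y (hp : 2 < p) (hodd : Odd p) {c : F} (hc : ∀ i, lam i ^ (p - 1) = c)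
    (g k : TwistedHeisenberg lam) (i : Fin m) :
    ((LieAlgebra.ad F _ g ^ (p - 1)) k) (.y i) =
      c * g .t ^ (p - 2) * (g .t * k (.y i) - k .t * g (.y i)) := by
  obtain ⟨q, hq⟩ := hodd
  rw [← hc i, show p - 1 = 2 * (q - 1) + 1 + 1 by omega, show p - 2 = 2 * (q - 1) + 1 by omega,
    pow_succ, pow_succ, Module.End.mul_apply, Module.End.mul_apply, LieAlgebra.ad_apply,
    LieAlgebra.ad_apply, ad_pow_even_y g (lie_t _ _), lie_y, lie_x, lie_t]
  ring

theorem ad_pow_sub_one_t (hp : 2 < p) (g k : TwistedHeisenberg lam) :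
    ((LieAlgebra.ad F _ g ^ (p - 1)) k) .t = 0 := by
  rw [show p - 1 = p - 2 + 1 by omega, pow_succ', Module.End.mul_apply, LieAlgebra.ad_apply, lie_t]

/-- The restricted structure with parameters `μ`. -/
noncomputable def stdStructure [CharP F p] [Fact p.Prime] (hp : 2 < p) (hodd : Odd p) {c : F}
    (hc : ∀ i, lam i ^ (p - 1) = c) (μ : HIdx m → F) :
    RestrictedStructure F p (TwistedHeisenberg lam) where
  pow := stdPow p lam c μ
  pow_smul a g := by
    ext k
    exact (isCompatible_stdPow hp hodd hc μ k).1 a g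
  pow_add g h := by
    ext k
    refine ((isCompatible_stdPow hp hodd hc μ k).2 g h).trans ?_
    rw [compatSum_d1 hp hodd]
    rfl
  ad_pow g := by
    have hx : ∀ i, stdPow p lam c μ g (.x i) = g .t ^ (p - 1) * (c * g (.x i)) := fun _ => rfl
    have hy : ∀ i, stdPow p lam c μ g (.y i) = g .t ^ (p - 1) * (c * g (.y i)) := fun _ => rfl
    have ht : stdPow p lam c μ g .t = c * g .t ^ p := rfl
    have h2 : g .t ^ (p - 1) = g .t ^ (p - 2) * g .t := by rw [← pow_succ]; congr 1; omega
    have h1 : g .t ^ p = g .t ^ (p - 2) * g .t * g .t := by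
      rw [← pow_succ, ← pow_succ]; congr 1; omega
    have key : ∀ k, (LieAlgebra.ad F _ g ^ p) k =
        ⁅g, (LieAlgebra.ad F _ g ^ (p - 1)) k⁆ := fun k => by
      conv_lhs => rw [show p = p - 1 + 1 by omega, pow_succ', Module.End.mul_apply,
        LieAlgebra.ad_apply]
    refine LinearMap.ext fun k => ?_
    rw [key, LieAlgebra.ad_apply]
    ext (i | i | _ | _)
    · rw [lie_x, lie_x, ad_pow_sub_one_y hp hodd hc, ad_pow_sub_one_t hp, hy, ht, h1, h2]
      ring
    · rw [lie_y, lie_y, ad_pow_sub_one_x hp hodd hc, ad_pow_sub_one_t hp, hx, ht, h1, h2]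
      ring
    · rw [lie_z, lie_z]
      refine Finset.sum_congr rfl fun i _ => ?_
      rw [ad_pow_sub_one_x hp hodd hc, ad_pow_sub_one_y hp hodd hc, hx, hy, h2]
      ring
    · rw [lie_t, lie_t]

theorem frobForm_e (hp : p ≠ 0) (μ : HIdx m → F) (k : HIdx m) :
    frobForm p lam μ (e lam k) = μ k := by
  cases k <;> simp [frobForm, e_apply, hp, ite_pow]

theorem hasParameters_stdStructure [CharP F p] [Fact p.Prime] (hp : 2 < p) (hodd : Odd p) {c : F}
    (hc : ∀ i, lam i ^ (p - 1) = c) (μ : HIdx m → F) :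
    HasParameters (stdStructure hp hodd hc μ) c μ := by
  have h1 : p - 1 ≠ 0 := by omega
  have h2 : p - 2 ≠ 0 := by omega
  refine ⟨fun k hk => ?_, ?_⟩
  · have hk' : e lam k .t = 0 := by rw [e_apply, if_neg hk.symm]
    ext (i | i | _ | _)
    · change e lam k .t ^ (p - 1) * _ = _
      rw [hk', zero_pow h1, smul_apply, e_apply .z]; simp
    · change e lam k .t ^ (p - 1) * _ = _
      rw [hk', zero_pow h1, smul_apply, e_apply .z]; simp
    · change e lam k .t ^ (p - 2) * _ + frobForm p lam μ (e lam k) = _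
      rw [hk', zero_pow h2, frobForm_e (by omega), smul_apply, e_apply]; simp
    · change c * e lam k .t ^ p = _
      rw [hk', zero_pow (by omega), smul_apply, e_apply]; simp
  · ext (i | i | _ | _)
    · change e lam .t .t ^ (p - 1) * (c * e lam .t (.x i)) = _
      simp [add_apply, smul_apply, e_apply]
    · change e lam .t .t ^ (p - 1) * (c * e lam .t (.y i)) = _
      simp [add_apply, smul_apply, e_apply]
    · change e lam .t .t ^ (p - 2) * (_ * d1 (coord lam .z) ![twist p lam (e lam .t), e lam .t]) +
        frobForm p lam μ (e lam .t) = _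
      rw [frobForm_e (by omega), d1_coord_z_twist]
      simp [add_apply, smul_apply, e_apply]
    · change c * e lam .t .t ^ p = _
      simp [add_apply, smul_apply, e_apply]

theorem HasParameters.pow_e {P : RestrictedStructure F p (TwistedHeisenberg lam)} {c : F}
    {μ : HIdx m → F} (h : HasParameters P c μ) (k : HIdx m) :
    P.pow (e lam k) = (if k = .t then c • e lam .t else 0) + μ k • e lam .z := by
  split_ifs with hk
  · rw [hk, h.2]
  · rw [h.1 k hk, zero_add]

/-- Each coordinate of either operator is compatible with the same coboundary, and both agree on the
basis. -/
theorem HasParameters.unique (hp : 2 < p) (hodd : Odd p)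
    {P P' : RestrictedStructure F p (TwistedHeisenberg lam)} {c : F}
    {μ : HIdx m → F} (h : HasParameters P c μ) (h' : HasParameters P' c μ) : P = P' := by
  have : P.pow = P'.pow := by
    funext g
    ext k
    exact congrFun (isCompatible_ext (by omega) (isCompatible_d1 hp hodd P (coord lam k))
      (isCompatible_d1 hp hodd P' (coord lam k)) fun l => by rw [h.pow_e, h'.pow_e]) g
  cases P; cases P'; congr

/-- Bracketing with `e_t` detects the `x` and `y` coordinates; the `t` coordinate needs some `x i`,
hence `1 ≤ m`. -/
theorem eq_smul_e_z_of_central (hm : 1 ≤ m) (hlam : ∀ i, lam i ≠ 0) {v : TwistedHeisenberg lam}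
    (hv : ∀ k : TwistedHeisenberg lam, ⁅v, k⁆ = 0) : v = v .z • e lam .z := by
  ext (i | i | _ | _)
  · have := congrArg (coord lam (.y i)) (hv (e lam .t))
    rw [coord_apply, lie_y] at this
    simpa [e_apply, smul_apply, hlam] using this
  · have := congrArg (coord lam (.x i)) (hv (e lam .t))
    rw [coord_apply, lie_x] at this
    simpa [e_apply, smul_apply, hlam] using this
  · simp [e_apply, smul_apply]
  · have := congrArg (coord lam (.y ⟨0, hm⟩)) (hv (e lam (.x ⟨0, hm⟩)))
    rw [coord_apply, lie_y] at this
    simpa [e_apply, smul_apply, hlam] using this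

theorem exists_hasParameters [CharP F p] [Fact p.Prime] (hp : 2 < p) (hodd : Odd p) (hm : 1 ≤ m)
    (hlam : ∀ i, lam i ≠ 0) {c : F} (hc : ∀ i, lam i ^ (p - 1) = c)
    (P : RestrictedStructure F p (TwistedHeisenberg lam)) :
    ∃ μ : HIdx m → F, HasParameters P c μ := by
  -- The structure with `μ = 0` is the reference point: `P.pow g` and `Q.pow g` have the same
  -- adjoint `(ad g) ^ p`, so they differ by a central vector.
  have hQ := hasParameters_stdStructure hp hodd hc (lam := lam) 0
  set Q := stdStructure hp hodd hc (lam := lam) 0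
  have key : ∀ g, P.pow g = Q.pow g + (P.pow g - Q.pow g) .z • e lam .z := fun g => by
    rw [← eq_smul_e_z_of_central hm hlam, add_sub_cancel]
    intro k
    rw [sub_lie, ← LieAlgebra.ad_apply F _ (P.pow g) k, ← LieAlgebra.ad_apply F _ (Q.pow g) k,
      ← P.ad_pow, ← Q.ad_pow, sub_self]
  refine ⟨fun k => (P.pow (e lam k) - Q.pow (e lam k)) .z, fun k hk => ?_, ?_⟩
  · have h0 : Q.pow (e lam k) = 0 := by rw [hQ.1 k hk]; exact zero_smul _ _
    refine (key _).trans ?_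
    beta_reduce
    rw [h0, zero_add]
  · have h0 : Q.pow (e lam .t) = c • e lam .t := by
      rw [hQ.2, Pi.zero_apply, zero_smul, add_zero]
    refine (key _).trans ?_
    beta_reduce
    rw [h0]

/-! ### The listed pairs are restricted cocycles. -/

theorem ordCocycle_xx (q : Pairs lam) (g h : TwistedHeisenberg lam) :
    ordCocycle lam (.inl (.inl q)) ![g, h] =
      (g (.x q.1.1) * h (.x q.1.2) - g (.x q.1.2) * h (.x q.1.1)) -
        lam q.1.1 * (lam q.1.2)⁻¹ *
          (g (.y q.1.1) * h (.y q.1.2) - g (.y q.1.2) * h (.y q.1.1)) := rfl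

theorem ordCocycle_xy (q : Pairs lam) (g h : TwistedHeisenberg lam) :
    ordCocycle lam (.inl (.inr q)) ![g, h] =
      (g (.x q.1.1) * h (.y q.1.2) - g (.y q.1.2) * h (.x q.1.1)) -
        lam q.1.1 * (lam q.1.2)⁻¹ *
          (g (.y q.1.1) * h (.x q.1.2) - g (.x q.1.2) * h (.y q.1.1)) := rfl

theorem ordCocycle_self (q : {i : Fin m // (i : ℕ) + 1 < m}) (g h : TwistedHeisenberg lam) :
    ordCocycle lam (.inr q) ![g, h] = g (.x q.1) * h (.y q.1) - g (.y q.1) * h (.x q.1) := rfl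

theorem ordCocycle_congr (k : OrdIdx lam) {g g' : TwistedHeisenberg lam}
    (hx : ∀ i, g (.x i) = g' (.x i)) (hy : ∀ i, g (.y i) = g' (.y i))
    (h : TwistedHeisenberg lam) : ordCocycle lam k ![g, h] = ordCocycle lam k ![g', h] := by
  rcases k with (q | q) | q
  · rw [ordCocycle_xx, ordCocycle_xx, hx, hx, hy, hy]
  · rw [ordCocycle_xy, ordCocycle_xy, hx, hx, hy, hy]
  · rw [ordCocycle_self, ordCocycle_self, hx, hy]

theorem cochain2_zero_left (φ : Cochain2 F (TwistedHeisenberg lam)) (g) : φ ![0, g] = 0 := by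
  simpa using cochain2_smul_left φ 0 0 g

theorem ordCocycle_e_z (k : OrdIdx lam) (g : TwistedHeisenberg lam) :
    ordCocycle lam k ![e lam .z, g] = 0 := by
  rw [ordCocycle_congr k (g' := 0), cochain2_zero_left] <;>
    exact fun i => by rw [e_apply, zero_apply]; simp

/-- The two signs `λ_i = ± λ_j`, handled at once. -/
theorem Pairs.exists_sign (hlam : ∀ i, lam i ≠ 0) (q : Pairs lam) :
    ∃ s : F, s * s = 1 ∧ lam q.1.1 = s * lam q.1.2 ∧ lam q.1.1 * (lam q.1.2)⁻¹ = s := by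
  rcases q.2.2 with h | h
  · exact ⟨1, by ring, by rw [h, one_mul], by rw [h, mul_inv_cancel₀ (hlam _)]⟩
  · exact ⟨-1, by ring, by rw [h]; ring, by rw [h, neg_mul, mul_inv_cancel₀ (hlam _)]⟩

/-- This is the symmetry required by `isCompatible_twist`. Writing `λ_i = s λ_j` with `s = ±1`, it
holds because `s ^ (p - 2) = s` for odd `p`. -/
theorem ordCocycle_twist (hp : 2 < p) (hodd : Odd p) (hlam : ∀ i, lam i ≠ 0) (k : OrdIdx lam)
    (g h : TwistedHeisenberg lam) :
    ordCocycle lam k ![twist p lam g, h] = ordCocycle lam k ![twist p lam h, g] := by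
  have hpow : ∀ s : F, s * s = 1 → s ^ (p - 2) = s := fun s hs => by
    obtain ⟨n, hn⟩ := hodd
    rw [show p - 2 = 2 * (n - 1) + 1 by omega, pow_succ, pow_mul, pow_two, hs, one_pow, one_mul]
  rcases k with (q | q) | q
  · obtain ⟨s, hs, h1, h2⟩ := q.exists_sign hlam
    simp only [ordCocycle_xx, twist_x, twist_y, h2]
    rw [h1, mul_pow, hpow s hs]
    linear_combination (-lam q.1.2 ^ (p - 2) * (g (.x q.1.1) * h (.y q.1.2) -
      h (.x q.1.1) * g (.y q.1.2))) * hs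
  · obtain ⟨s, hs, h1, h2⟩ := q.exists_sign hlam
    simp only [ordCocycle_xy, twist_x, twist_y, h2]
    rw [h1, mul_pow, hpow s hs]
    linear_combination (-lam q.1.2 ^ (p - 2) * (g (.x q.1.1) * h (.x q.1.2) -
      h (.x q.1.1) * g (.x q.1.2))) * hs
  · simp only [ordCocycle_self, twist_x, twist_y]
    ring

theorem d2_ordCocycle (hlam : ∀ i, lam i ≠ 0) (k : OrdIdx lam) : d2 (ordCocycle lam k) = 0 := by
  funext g h f
  change ordCocycle lam k ![⁅g, h⁆, f] - ordCocycle lam k ![⁅g, f⁆, h] +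
    ordCocycle lam k ![⁅h, f⁆, g] = 0
  rcases k with (q | q) | q
  · obtain ⟨s, hs, h1, h2⟩ := q.exists_sign hlam
    simp only [ordCocycle_xx, lie_x, lie_y, h2]
    rw [h1]
    linear_combination (-lam q.1.2 * ((g .t * h (.x q.1.1) - h .t * g (.x q.1.1)) * f (.y q.1.2) -
      (g .t * f (.x q.1.1) - f .t * g (.x q.1.1)) * h (.y q.1.2) +
      (h .t * f (.x q.1.1) - f .t * h (.x q.1.1)) * g (.y q.1.2))) * hs
  · obtain ⟨s, hs, h1, h2⟩ := q.exists_sign hlam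
    simp only [ordCocycle_xy, lie_x, lie_y, h2]
    rw [h1]
    linear_combination (-lam q.1.2 * ((g .t * h (.x q.1.1) - h .t * g (.x q.1.1)) * f (.x q.1.2) -
      (g .t * f (.x q.1.1) - f .t * g (.x q.1.1)) * h (.x q.1.2) +
      (h .t * f (.x q.1.1) - f .t * h (.x q.1.1)) * g (.x q.1.2))) * hs
  · simp only [ordCocycle_self, lie_x, lie_y]
    ring

theorem exists_isTilde [CharP F p] (hp : 2 < p) (hodd : Odd p) (hlam : ∀ i, lam i ≠ 0)
    (k : OrdIdx lam) : ∃ ω, IsTilde p (ordCocycle lam k) ω := by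
  refine ⟨_, isCompatible_twist hp hodd (ordCocycle_e_z k) (ordCocycle_twist hp hodd hlam k),
    fun l => ?_⟩
  by_cases hl : l = .t
  · have : twist p lam (e lam .t) = 0 := by
      ext (_ | _ | _ | _)
      · rw [twist_x, e_apply, zero_apply]; simp
      · rw [twist_y, e_apply, zero_apply]; simp
      · rfl
      · rfl
    rw [hl, this, cochain2_zero_left]
    simp
  · rw [e_apply, if_neg (Ne.symm hl), zero_pow (by omega), zero_mul]

theorem IsTilde.unique (hp : p ≠ 0) {φ : Cochain2 F (TwistedHeisenberg lam)}
    {ω ω' : TwistedHeisenberg lam → F} (h : IsTilde p φ ω) (h' : IsTilde p φ ω') : ω = ω' :=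
  isCompatible_ext hp h.1 h'.1 fun k => by rw [h.2, h'.2]

theorem iterate_lie_even (h : TwistedHeisenberg lam) (n : ℕ) (g : TwistedHeisenberg lam) :
    (fun x => ⁅x, h⁆)^[2 * n] g = (LieAlgebra.ad F _ h ^ (2 * n)) g := by
  induction n with
  | zero => rfl
  | succ n ih =>
    rw [show 2 * (n + 1) = 2 * n + 1 + 1 by ring, Function.iterate_succ_apply',
      Function.iterate_succ_apply', ih, pow_succ', pow_succ', Module.End.mul_apply,
      Module.End.mul_apply, LieAlgebra.ad_apply, LieAlgebra.ad_apply, ← lie_skew, ← lie_skew _ h,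
      lie_neg, neg_neg]

theorem mk_ordCocycle_mem [CharP F p] [Fact p.Prime] (hp : 2 < p) (hodd : Odd p)
    (hlam : ∀ i, lam i ≠ 0) {c : F} (hc : ∀ i, lam i ^ (p - 1) = c)
    {P : RestrictedStructure F p (TwistedHeisenberg lam)} {μ : HIdx m → F}
    (hP : HasParameters P c μ) (k : OrdIdx lam) {ω : TwistedHeisenberg lam → F}
    (hω : IsCompatible p (ordCocycle lam k) ω) :
    CochainPair.mk (ordCocycle lam k) ω ∈ restrictedCocycle2 P := by
  refine ⟨hω, LinearMap.mem_ker.2 (Prod.ext (d2_ordCocycle hlam k) ?_)⟩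
  funext g h
  change ordCocycle lam k ![g, P.pow h] -
    ordCocycle lam k ![(fun x => ⁅x, h⁆)^[p - 1] g, h] = 0
  have he : p - 1 = 2 * ((p - 1) / 2) := by obtain ⟨q, rfl⟩ := hodd; omega
  have h1 : (fun x => ⁅x, h⁆)^[p - 1] g = (LieAlgebra.ad F _ h ^ (p - 1)) g := by
    rw [he, iterate_lie_even]
  rw [hP.unique hp hodd (hasParameters_stdStructure hp hodd hc μ), h1, cochain2_swap,
    -- The listed forms see only `x` and `y` coordinates. There `h^[p]` is `c h_t^(p-1) h` and `(ad
    -- h)^(p-1) g` is `c h_t^(p-2) (h_t g - g_t h)`, so both sides of the restricted condition equal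
    -- `c h_t^(p-1) φ(g, h)`.
    ordCocycle_congr k (g := (stdStructure hp hodd hc μ).pow h) (g' := (c * h .t ^ (p - 1)) • h),
    ordCocycle_congr k (g := (LieAlgebra.ad F _ h ^ (p - 1)) g)
      (g' := (c * h .t ^ (p - 2)) • (h .t • g + (-g .t) • h)), cochain2_smul_left,
    cochain2_smul_left, cochain2_add_left, cochain2_smul_left, cochain2_smul_left, cochain2_self,
    cochain2_swap _ h, show p - 1 = p - 2 + 1 by omega]
  · ring
  · intro i
    rw [ad_pow_sub_one_x hp hodd hc]
    simp only [smul_apply, add_apply]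
    ring
  · intro i
    rw [ad_pow_sub_one_y hp hodd hc]
    simp only [smul_apply, add_apply]
    ring
  · intro i
    rw [smul_apply]
    change h .t ^ (p - 1) * (c * h (.x i)) = _
    ring
  · intro i
    rw [smul_apply]
    change h .t ^ (p - 1) * (c * h (.y i)) = _
    ring

theorem mk_eBar_mem [CharP F p] [Fact p.Prime] (P : RestrictedStructure F p (TwistedHeisenberg lam))
    (k : HIdx m) : CochainPair.mk (0 : Cochain2 F (TwistedHeisenberg lam)) (eBar p lam k) ∈
      restrictedCocycle2 P := by
  refine ⟨isCompatible_eBar k, LinearMap.mem_ker.2 (Prod.ext (map_zero d2) ?_)⟩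
  funext g h
  exact sub_self 0

/-! ### Dual functionals on cochain pairs. -/

/-- Coordinates on `H²_*`, dual to the proposed basis; `l` is the last index and `μ` the parameters
of the restricted structure. -/
def cohomCoord (lam : Fin m → F) (l : Fin m) (μ : HIdx m → F) :
    CochainPair F (TwistedHeisenberg lam) →ₗ[F] (OrdIdx lam ⊕ {k : HIdx m // k ≠ HIdx.t} → F) where
  toFun b
    | .inl (.inl (.inl q)) => b.1 ![e lam (.x q.1.1), e lam (.x q.1.2)]
    | .inl (.inl (.inr q)) => b.1 ![e lam (.x q.1.1), e lam (.y q.1.2)]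
    -- The coboundary of `e_z^*` is `∑ e^{i,m+i}` together with a map taking the value `μ_k` at
    -- `e_k`; the subtractions here and in the next case make the functionals vanish on it.
    | .inl (.inr q) => b.1 ![e lam (.x q.1), e lam (.y q.1)] - b.1 ![e lam (.x l), e lam (.y l)]
    | .inr k => b.2 (e lam k.1) - μ k.1 * b.1 ![e lam (.x l), e lam (.y l)]
  map_add' b b' := by
    funext k
    rcases k with ((q | q) | q) | k
    · rfl
    · rfl
    · exact add_sub_add_comm _ _ _ _
    · exact (congrArg _ (mul_add _ _ _)).trans (add_sub_add_comm _ _ _ _)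
  map_smul' a b := by
    funext k
    rcases k with ((q | q) | q) | k
    · rfl
    · rfl
    · exact (mul_sub _ _ _).symm
    · exact (congrArg _ (mul_left_comm _ _ _)).trans (mul_sub _ _ _).symm

variable (l : Fin m) (μ : HIdx m → F)

theorem cohomCoord_xx (b : CochainPair F (TwistedHeisenberg lam)) (q : Pairs lam) :
    cohomCoord lam l μ b (.inl (.inl (.inl q))) =
      b.1 ![e lam (.x q.1.1), e lam (.x q.1.2)] := rfl

theorem cohomCoord_xy (b : CochainPair F (TwistedHeisenberg lam)) (q : Pairs lam) :
    cohomCoord lam l μ b (.inl (.inl (.inr q))) =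
      b.1 ![e lam (.x q.1.1), e lam (.y q.1.2)] := rfl

theorem cohomCoord_self (b : CochainPair F (TwistedHeisenberg lam))
    (q : {i : Fin m // (i : ℕ) + 1 < m}) : cohomCoord lam l μ b (.inl (.inr q)) =
      b.1 ![e lam (.x q.1), e lam (.y q.1)] - b.1 ![e lam (.x l), e lam (.y l)] := rfl

theorem cohomCoord_inr (b : CochainPair F (TwistedHeisenberg lam)) (k : {k : HIdx m // k ≠ .t}) :
    cohomCoord lam l μ b (.inr k) =
      b.2 (e lam k.1) - μ k.1 * b.1 ![e lam (.x l), e lam (.y l)] := rfl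

variable {l μ}

theorem ordCocycle_last (hl : (l : ℕ) + 1 = m) (k : OrdIdx lam) :
    ordCocycle lam k ![e lam (.x l), e lam (.y l)] = 0 := by
  rcases k with (q | q) | q
  · simp [ordCocycle_xx, e_apply]
  · have := q.2.1.ne
    simp only [ordCocycle_xy, e_apply]
    simp
    grind
  · have : q.1 ≠ l := fun h => by have := q.2; rw [h] at this; omega
    simp [ordCocycle_self, e_apply, this]

open Classical in
theorem cohomCoord_ordCocycle (hl : (l : ℕ) + 1 = m) (k : OrdIdx lam)
    {ω : TwistedHeisenberg lam → F} (hω : ∀ k, ω (e lam k) = 0) :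
    cohomCoord lam l μ (CochainPair.mk (ordCocycle lam k) ω) = Pi.single (.inl k) 1 := by
  have h1 : (CochainPair.mk (ordCocycle lam k) ω).1 = ordCocycle lam k := rfl
  have h2 : (CochainPair.mk (ordCocycle lam k) ω).2 = ω := rfl
  funext k'
  rw [Pi.single_apply]
  rcases k' with ((q' | q') | q') | k'
  · rw [cohomCoord_xx, h1]
    have := q'.2.1
    rcases k with (q | q) | q
    · have := q.2.1
      simp only [ordCocycle_xx, e_apply]
      simp [Subtype.ext_iff, Prod.ext_iff]
      grind
    · simp [ordCocycle_xy, e_apply]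
    · simp [ordCocycle_self, e_apply]
  · rw [cohomCoord_xy, h1]
    have := q'.2.1
    rcases k with (q | q) | q
    · simp [ordCocycle_xx, e_apply]
    · have := q.2.1
      simp only [ordCocycle_xy, e_apply]
      simp [Subtype.ext_iff, Prod.ext_iff]
      grind
    · simp [ordCocycle_self, e_apply]
      grind
  · rw [cohomCoord_self, h1, ordCocycle_last hl, sub_zero]
    rcases k with (q | q) | q
    · simp [ordCocycle_xx, e_apply]
    · have := q.2.1
      simp only [ordCocycle_xy, e_apply]
      simp
      grind
    · simp [ordCocycle_self, e_apply, Subtype.ext_iff]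
      grind
  · rw [cohomCoord_inr, h1, h2, ordCocycle_last hl, hω]
    simp

open Classical in
theorem cohomCoord_eBar (hp : p ≠ 0) (k : {k : HIdx m // k ≠ .t}) :
    cohomCoord lam l μ (CochainPair.mk 0 (eBar p lam k.1)) = Pi.single (.inr k) 1 := by
  have h1 : (CochainPair.mk (0 : Cochain2 F (TwistedHeisenberg lam)) (eBar p lam k.1)).1 = 0 := rfl
  have h2 : (CochainPair.mk (0 : Cochain2 F (TwistedHeisenberg lam)) (eBar p lam k.1)).2 =
    eBar p lam k.1 := rfl
  funext k'
  rw [Pi.single_apply]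
  rcases k' with ((q' | q') | q') | k'
  · rw [cohomCoord_xx, h1]; simp
  · rw [cohomCoord_xy, h1]; simp
  · rw [cohomCoord_self, h1]; simp
  · rw [cohomCoord_inr, h1, h2, eBar, e_apply]
    simp [ite_pow, hp, Subtype.ext_iff, eq_comm]

/-! ### The common kernel of the functionals consists of coboundaries. -/

theorem lie_e_t_x (i : Fin m) : ⁅e lam .t, e lam (.x i)⁆ = lam i • e lam (.y i) := by
  ext (j | j | _ | _) <;>
    simp +contextual [lie_x, lie_y, lie_z, lie_t, smul_apply, e_apply]

theorem lie_e_t_y (i : Fin m) : ⁅e lam .t, e lam (.y i)⁆ = lam i • e lam (.x i) := by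
  ext (j | j | _ | _) <;>
    simp +contextual [lie_x, lie_y, lie_z, lie_t, smul_apply, e_apply]

theorem lie_e_x_t (i : Fin m) : ⁅e lam (.x i), e lam .t⁆ = (-lam i) • e lam (.y i) := by
  rw [← lie_skew, lie_e_t_x, neg_smul]

theorem lie_e_y_t (i : Fin m) : ⁅e lam (.y i), e lam .t⁆ = (-lam i) • e lam (.x i) := by
  rw [← lie_skew, lie_e_t_y, neg_smul]

theorem lie_e_x_x (i j : Fin m) : ⁅e lam (.x i), e lam (.x j)⁆ = 0 := by
  ext (k | k | _ | _) <;> simp [lie_x, lie_y, lie_z, lie_t, zero_apply, e_apply]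

theorem lie_e_y_y (i j : Fin m) : ⁅e lam (.y i), e lam (.y j)⁆ = 0 := by
  ext (k | k | _ | _) <;> simp [lie_x, lie_y, lie_z, lie_t, zero_apply, e_apply]

theorem lie_e_x_y (i j : Fin m) :
    ⁅e lam (.x i), e lam (.y j)⁆ = (if i = j then (1 : F) else 0) • e lam .z := by
  ext (k | k | _ | _) <;>
    simp [lie_x, lie_y, lie_z, lie_t, smul_apply, e_apply, Finset.sum_ite_eq, eq_comm]

theorem cohomCoord_d1Star {c : F} {P : RestrictedStructure F p (TwistedHeisenberg lam)}
    (hP : HasParameters P c μ) (ψ : Module.Dual F (TwistedHeisenberg lam)) :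
    cohomCoord lam l μ (d1Star P ψ) = 0 := by
  have h1 : (d1Star P ψ).1 = d1 ψ := rfl
  have h2 : (d1Star P ψ).2 = fun g => ψ (P.pow g) := rfl
  funext k
  rcases k with ((q | q) | q) | k
  · rw [cohomCoord_xx, h1, d1_apply, lie_e_x_x, map_zero]; rfl
  · rw [cohomCoord_xy, h1, d1_apply, lie_e_x_y, if_neg q.2.1.ne, zero_smul, map_zero]; rfl
  · rw [cohomCoord_self, h1, d1_apply, d1_apply, lie_e_x_y, lie_e_x_y, if_pos rfl, if_pos rfl,
      sub_self]; rfl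
  · rw [cohomCoord_inr, h1, h2, d1_apply, lie_e_x_y, if_pos rfl, one_smul]
    beta_reduce
    rw [hP.1 k.1 k.2, map_smul, smul_eq_mul, sub_self]; rfl

/-- The linear form with prescribed values on the basis. -/
def dualOf (lam : Fin m → F) (v : HIdx m → F) : Module.Dual F (TwistedHeisenberg lam) :=
  ∑ i, (v (.x i) • coord lam (.x i) + v (.y i) • coord lam (.y i)) + v .z • coord lam .z +
    v .t • coord lam .t

theorem dualOf_e (v : HIdx m → F) (k : HIdx m) : dualOf lam v (e lam k) = v k := by
  cases k <;> simp [dualOf, coord_apply, e_apply]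

/-- A cocycle with vanishing `cohomCoord` is determined by its values on the pairs `(e_t, e_k)` and
on `(x_l, y_l)`. -/
theorem cocycle_values (hp : 2 < p) (hlam : ∀ i, lam i ≠ 0) {c : F} (hc0 : c ≠ 0)
    {P : RestrictedStructure F p (TwistedHeisenberg lam)} (hP : HasParameters P c μ)
    (hl : (l : ℕ) + 1 = m) {b : CochainPair F (TwistedHeisenberg lam)}
    (hb : b ∈ LinearMap.ker (d2Star P)) (hb0 : cohomCoord lam l μ b = 0) :
    (∀ k, b.1 ![e lam .z, e lam k] = 0) ∧
    (∀ i j, b.1 ![e lam (.x i), e lam (.x j)] = 0) ∧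
    (∀ i j, b.1 ![e lam (.y i), e lam (.y j)] = 0) ∧
    ∀ i j, b.1 ![e lam (.x i), e lam (.y j)] =
      (if i = j then 1 else 0) * b.1 ![e lam (.x l), e lam (.y l)] := by
  have hker := LinearMap.mem_ker.1 hb
  have hd2 : ∀ g h f, b.1 ![⁅g, h⁆, f] - b.1 ![⁅g, f⁆, h] + b.1 ![⁅h, f⁆, g] = 0 := fun g h f =>
    congrFun (congrFun (congrFun (congrArg Prod.fst hker) g) h) f
  have hind : ∀ g h, b.1 ![g, P.pow h] - b.1 ![(fun x => ⁅x, h⁆)^[p - 1] g, h] = 0 := fun g h =>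
    congrFun (congrFun (congrArg Prod.snd hker) g) h
  set φ := b.1
  have hzx : ∀ i, φ ![e lam .z, e lam (.x i)] = 0 := fun i => by
    -- Only the bracket of `y i` with `e_t` survives, leaving `λ_i φ(e_z, x_i) = 0`.
    have := hd2 (e lam (.y i)) (e lam .z) (e lam .t)
    rw [lie_e_z, lie_e_y_t, lie_e_z_left, cochain2_zero_left, cochain2_zero_left,
      cochain2_smul_left, cochain2_swap φ (e lam (.x i))] at this
    simpa [hlam i] using this
  have hzy : ∀ i, φ ![e lam .z, e lam (.y i)] = 0 := fun i => by
    have := hd2 (e lam (.x i)) (e lam .z) (e lam .t)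
    rw [lie_e_z, lie_e_x_t, lie_e_z_left, cochain2_zero_left, cochain2_zero_left,
      cochain2_smul_left, cochain2_swap φ (e lam (.y i))] at this
    simpa [hlam i] using this
  have hzt : φ ![e lam .z, e lam .t] = 0 := by
    -- The iterated bracket vanishes, so `φ(e_z, e_t^[p]) = c φ(e_z, e_t)` is zero.
    have := hind (e lam .z) (e lam .t)
    have h0 : ∀ n, (fun x => ⁅x, e lam .t⁆)^[n] (0 : TwistedHeisenberg lam) = 0 := fun n =>
      Function.iterate_fixed (f := fun x => ⁅x, e lam .t⁆) (zero_lie _) n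
    rw [show p - 1 = p - 2 + 1 by omega, Function.iterate_succ_apply, lie_e_z_left, h0,
      cochain2_zero_left, hP.2, cochain2_add_right, cochain2_smul_right, cochain2_smul_right,
      cochain2_self] at this
    simpa [hc0] using this
  have hz : ∀ k, φ ![e lam .z, e lam k] = 0 := fun k => by
    cases k
    exacts [hzx _, hzy _, cochain2_self _ _, hzt]
  have hxx : ∀ i j, lam i * φ ![e lam (.y i), e lam (.x j)] +
      lam j * φ ![e lam (.x i), e lam (.y j)] = 0 := fun i j => by
    have := hd2 (e lam (.x i)) (e lam (.x j)) (e lam .t)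
    rw [lie_e_x_x, lie_e_x_t, lie_e_x_t, cochain2_zero_left, cochain2_smul_left,
      cochain2_smul_left, cochain2_swap φ (e lam (.y j))] at this
    linear_combination this
  have hyy : ∀ i j, lam i * φ ![e lam (.x i), e lam (.y j)] +
      lam j * φ ![e lam (.y i), e lam (.x j)] = 0 := fun i j => by
    have := hd2 (e lam (.y i)) (e lam (.y j)) (e lam .t)
    rw [lie_e_y_y, lie_e_y_t, lie_e_y_t, cochain2_zero_left, cochain2_smul_left,
      cochain2_smul_left, cochain2_swap φ (e lam (.x j))] at this
    linear_combination this
  have hxy : ∀ i j, lam i * φ ![e lam (.y i), e lam (.y j)] +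
      lam j * φ ![e lam (.x i), e lam (.x j)] = 0 := fun i j => by
    have := hd2 (e lam (.x i)) (e lam (.y j)) (e lam .t)
    -- For `i = j` the bracket contributes `φ(e_z, e_t)`, removed by `hzt`.
    rw [lie_e_x_y, lie_e_x_t, lie_e_y_t, cochain2_smul_left, hzt, cochain2_smul_left,
      cochain2_smul_left, cochain2_swap φ (e lam (.x j))] at this
    linear_combination this
  have hsign : ∀ i j, lam i * lam i - lam j * lam j = 0 → lam i = lam j ∨ lam i = -lam j :=
    fun i j h => mul_self_eq_mul_self_iff.1 (sub_eq_zero.1 h)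
  have hxxlt : ∀ i j, i < j → φ ![e lam (.x i), e lam (.x j)] = 0 := fun i j hij => by
    by_cases hs : lam i = lam j ∨ lam i = -lam j
    · exact congrFun hb0 (.inl (.inl (.inl ⟨(i, j), hij, hs⟩)))
    · have h1 := hxy i j
      have h2 := hxy j i
      rw [cochain2_swap φ (e lam (.y j)), cochain2_swap φ (e lam (.x j))] at h2
      refine (mul_eq_zero.1 ?_).resolve_left fun h => hs (hsign i j h)
      -- Eliminating `φ(y_i, y_j)` leaves `(λ_i² - λ_j²) φ(x_i, x_j) = 0`.
      linear_combination (-lam j) * h1 - lam i * h2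
  have hxx0 : ∀ i j, φ ![e lam (.x i), e lam (.x j)] = 0 := fun i j => by
    rcases lt_trichotomy i j with h | rfl | h
    · exact hxxlt i j h
    · exact cochain2_self _ _
    · rw [cochain2_swap, hxxlt j i h, neg_zero]
  refine ⟨hz, hxx0, fun i j => ?_, fun i j => ?_⟩
  · have := hxy i j
    rw [hxx0, mul_zero, add_zero] at this
    exact (mul_eq_zero.1 this).resolve_left (hlam i)
  · have hlt : ∀ i j, i < j → φ ![e lam (.x i), e lam (.y j)] = 0 := fun i j hij => by
      by_cases hs : lam i = lam j ∨ lam i = -lam j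
      · exact congrFun hb0 (.inl (.inl (.inr ⟨(i, j), hij, hs⟩)))
      · refine (mul_eq_zero.1 ?_).resolve_left fun h => hs (hsign i j h)
        linear_combination lam i * hyy i j - lam j * hxx i j
    rcases lt_trichotomy i j with h | rfl | h
    · rw [hlt i j h, if_neg h.ne, zero_mul]
    · rw [if_pos rfl, one_mul]
      by_cases h : (i : ℕ) + 1 < m
      · exact sub_eq_zero.1 (congrFun hb0 (.inl (.inr ⟨i, h⟩)))
      · have : i = l := Fin.ext (by have := i.2; omega)
        rw [this]
    · have := hxx j i
      rw [hlt j i h, mul_zero, add_zero, cochain2_swap] at this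
      rw [if_neg h.ne', zero_mul]
      simpa [hlam j] using this

theorem mem_range_d1Star (hp : 2 < p) (hodd : Odd p) (hlam : ∀ i, lam i ≠ 0) {c : F} (hc0 : c ≠ 0)
    {P : RestrictedStructure F p (TwistedHeisenberg lam)} (hP : HasParameters P c μ)
    (hl : (l : ℕ) + 1 = m) {b : CochainPair F (TwistedHeisenberg lam)}
    (hb : b ∈ restrictedCocycle2 P) (hb0 : cohomCoord lam l μ b = 0) :
    b ∈ restrictedCoboundary2 P := by
  obtain ⟨hz, hxx, hyy, hxy⟩ := cocycle_values hp hlam hc0 hP hl hb.2 hb0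
  obtain ⟨φ, ω⟩ := b
  have hω : IsCompatible p φ ω := hb.1
  change ∀ k, φ ![e lam .z, e lam k] = 0 at hz
  change ∀ i j, φ ![e lam (.x i), e lam (.x j)] = 0 at hxx
  change ∀ i j, φ ![e lam (.y i), e lam (.y j)] = 0 at hyy
  change ∀ i j, φ ![e lam (.x i), e lam (.y j)] =
      (if i = j then 1 else 0) * φ ![e lam (.x l), e lam (.y l)] at hxy
  have hω0 : ∀ k, k ≠ .t → ω (e lam k) = μ k * φ ![e lam (.x l), e lam (.y l)] := fun k hk =>
    sub_eq_zero.1 (congrFun hb0 (.inr ⟨k, hk⟩))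
  -- The values are forced: `⁅e_t, x_i⁆ = λ_i y_i` and `⁅e_t, y_i⁆ = λ_i x_i` fix `ψ` on `y_i` and
  -- `x_i`, `⁅x_l, y_l⁆ = e_z` fixes it on `e_z`, and `ψ(e_t^[p]) = ω(e_t)` fixes it on `e_t`.
  let v : HIdx m → F
    | .x i => (lam i)⁻¹ * φ ![e lam .t, e lam (.y i)]
    | .y i => (lam i)⁻¹ * φ ![e lam .t, e lam (.x i)]
    | .z => φ ![e lam (.x l), e lam (.y l)]
    | .t => c⁻¹ * (ω (e lam .t) - μ .t * φ ![e lam (.x l), e lam (.y l)])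
  have hφ : φ = d1 (dualOf lam v) := by
    have hsw : ∀ k k', φ ![e lam k, e lam k'] = d1 (dualOf lam v) ![e lam k, e lam k'] →
        φ ![e lam k', e lam k] = d1 (dualOf lam v) ![e lam k', e lam k] := fun k k' h => by
      rw [cochain2_swap, h, ← cochain2_swap]
    have hz' : ∀ k, φ ![e lam .z, e lam k] = d1 (dualOf lam v) ![e lam .z, e lam k] := fun k => by
      rw [hz, d1_e_z]
    have hxy' : ∀ i j, φ ![e lam (.x i), e lam (.y j)] =
        d1 (dualOf lam v) ![e lam (.x i), e lam (.y j)] := fun i j => by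
      rw [hxy, d1_apply, lie_e_x_y, map_smul, dualOf_e, smul_eq_mul]
    have htx : ∀ i, φ ![e lam .t, e lam (.x i)] =
        d1 (dualOf lam v) ![e lam .t, e lam (.x i)] := fun i => by
      rw [d1_apply, lie_e_t_x, map_smul, dualOf_e, smul_eq_mul, mul_inv_cancel_left₀ (hlam i)]
    have hty : ∀ i, φ ![e lam .t, e lam (.y i)] =
        d1 (dualOf lam v) ![e lam .t, e lam (.y i)] := fun i => by
      rw [d1_apply, lie_e_t_y, map_smul, dualOf_e, smul_eq_mul, mul_inv_cancel_left₀ (hlam i)]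
    refine cochain2_ext fun k k' => ?_
    rcases k with i | i | _ | _ <;> rcases k' with j | j | _ | _
    · rw [hxx, d1_apply, lie_e_x_x, map_zero]
    · exact hxy' i j
    · exact hsw _ _ (hz' _)
    · exact hsw _ _ (htx i)
    · exact hsw _ _ (hxy' j i)
    · rw [hyy, d1_apply, lie_e_y_y, map_zero]
    · exact hsw _ _ (hz' _)
    · exact hsw _ _ (hty i)
    · exact hz' _
    · exact hz' _
    · exact hz' _
    · exact hz' _
    · exact htx j
    · exact hty j
    · exact hsw _ _ (hz' _)
    · rw [cochain2_self, cochain2_self]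
  refine ⟨dualOf lam v, Prod.ext hφ.symm ?_⟩
  refine isCompatible_ext (φ := φ) (by omega) (hφ ▸ isCompatible_d1 hp hodd P _) hω fun k => ?_
  change dualOf lam v (P.pow (e lam k)) = ω (e lam k)
  rw [hP.pow_e, map_add, map_smul, dualOf_e]
  split_ifs with hk
  · rw [hk, map_smul, dualOf_e]
    change c * (c⁻¹ * (ω (e lam .t) - μ .t * _)) + μ .t * _ = _
    rw [mul_inv_cancel_left₀ hc0]
    exact sub_add_cancel _ _
  · rw [hω0 k hk, map_zero, zero_add]
    rfl

/-! ### Dimension count and assembly. -/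

/-- The basis elements other than `e_t`. -/
def neTEquiv (m : ℕ) : {k : HIdx m // k ≠ HIdx.t} ≃ (Fin m ⊕ Fin m) ⊕ Unit where
  toFun
    | ⟨.x i, _⟩ => .inl (.inl i)
    | ⟨.y i, _⟩ => .inl (.inr i)
    | ⟨.z, _⟩ => .inr ()
    | ⟨.t, h⟩ => (h rfl).elim
  invFun
    | .inl (.inl i) => ⟨.x i, by simp⟩
    | .inl (.inr i) => ⟨.y i, by simp⟩
    | .inr _ => ⟨.z, by simp⟩
  left_inv := by rintro ⟨_ | _ | _ | _, h⟩ <;> first | rfl | exact (h rfl).elim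
  right_inv := by rintro ((_ | _) | _) <;> rfl

theorem card_basisIdx (hm : 1 ≤ m) :
    Nat.card (OrdIdx lam ⊕ {k : HIdx m // k ≠ HIdx.t}) = 2 * Nat.card (Pairs lam) + 3 * m := by
  have h1 : Nat.card {i : Fin m // (i : ℕ) + 1 < m} = m - 1 := by
    have E : {i : Fin m // (i : ℕ) + 1 < m} ≃ Fin (m - 1) :=
      { toFun := fun i => ⟨i.1, by have := i.2; omega⟩
        invFun := fun i => ⟨⟨i, by omega⟩, by have := i.2; simp only; omega⟩
        left_inv := fun _ => rfl
        right_inv := fun _ => rfl }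
    rw [Nat.card_congr E, Nat.card_fin]
  have : Finite {k : HIdx m // k ≠ HIdx.t} := Finite.of_equiv _ (neTEquiv m).symm
  rw [Nat.card_sum, Nat.card_sum, Nat.card_sum, h1, Nat.card_congr (neTEquiv m), Nat.card_sum,
    Nat.card_sum, Nat.card_fin, Nat.card_unique (α := Unit)]
  omega

/-- `H²_*` in coordinates. -/
theorem exists_cohomEquiv [CharP F p] [Fact p.Prime] (hp : 2 < p) (hodd : Odd p)
    (hlam : ∀ i, lam i ≠ 0) {c : F} (hc0 : c ≠ 0) (hc : ∀ i, lam i ^ (p - 1) = c)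
    {P : RestrictedStructure F p (TwistedHeisenberg lam)} (hP : HasParameters P c μ)
    (hl : (l : ℕ) + 1 = m) :
    ∃ E : RestrictedH2 P ≃ₗ[F] (OrdIdx lam ⊕ {k : HIdx m // k ≠ HIdx.t} → F),
      ∀ b (hb : b ∈ restrictedCocycle2 P), E (restrictedClass P b hb) = cohomCoord lam l μ b := by
  classical
  have : Finite {k : HIdx m // k ≠ HIdx.t} := Finite.of_equiv _ (neTEquiv m).symm
  let Θ := cohomCoord lam l μ ∘ₗ (restrictedCocycle2 P).subtype
  have hle : (restrictedCoboundary2 P).submoduleOf (restrictedCocycle2 P) ≤ LinearMap.ker Θ := by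
    rintro ⟨b, hb⟩ ⟨ψ, hψ⟩
    rw [LinearMap.mem_ker]
    change cohomCoord lam l μ b = 0
    rw [show b = d1Star P ψ from hψ.symm, cohomCoord_d1Star hP]
  have hinj : Function.Injective (Submodule.liftQ _ Θ hle) := by
    rw [← LinearMap.ker_eq_bot, Submodule.ker_liftQ_eq_bot]
    rintro ⟨b, hb⟩ h
    exact mem_range_d1Star hp hodd hlam hc0 hP hl hb h
  have hsurj : Function.Surjective (Submodule.liftQ _ Θ hle) := by
    rw [← LinearMap.range_eq_top, Submodule.range_liftQ, eq_top_iff,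
      -- The listed cocycles map to the standard basis, which gives surjectivity and later
      -- identifies the basis of `H²_*`.
      ← (Pi.basisFun F (OrdIdx lam ⊕ {k : HIdx m // k ≠ HIdx.t})).span_eq, Submodule.span_le]
    rintro _ ⟨k | k, rfl⟩
    · obtain ⟨ω, hω⟩ := exists_isTilde hp hodd hlam k
      exact ⟨⟨_, mk_ordCocycle_mem hp hodd hlam hc hP k hω.1⟩, by
        rw [Pi.basisFun_apply]; exact cohomCoord_ordCocycle hl k hω.2⟩
    · exact ⟨⟨_, mk_eBar_mem P k.1⟩, by
        rw [Pi.basisFun_apply]; exact cohomCoord_eBar (by omega) k⟩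
  exact ⟨LinearEquiv.ofBijective _ ⟨hinj, hsurj⟩, fun _ _ => rfl⟩

end TwistedHeisenberg

theorem mainTheorem1 {F : Type*} [Field F] [IsAlgClosed F] (p : ℕ) [CharP F p] (hp : 2 < p)
    (m : ℕ) (hm : 1 ≤ m) (lam : Fin m → F) (hlam : ∀ i, lam i ≠ 0)
    (c : F) (hc : ∀ i, lam i ^ (p - 1) = c) :
    -- every parameter vector `μ` determines exactly one restricted structure
    (∀ μ : HIdx m → F, ∃! P : RestrictedStructure F p (TwistedHeisenberg lam),
      TwistedHeisenberg.HasParameters P c μ) ∧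
    -- the map `φ̃` exists and is unique for each of the listed cocycles `φ`
    (∀ k : TwistedHeisenberg.OrdIdx lam, ∃! ω : TwistedHeisenberg lam → F,
      TwistedHeisenberg.IsTilde p (TwistedHeisenberg.ordCocycle lam k) ω) ∧
    -- the restricted cohomology, for every restricted structure
    ∀ P : RestrictedStructure F p (TwistedHeisenberg lam),
      (∃ μ : HIdx m → F, TwistedHeisenberg.HasParameters P c μ) ∧
      Module.finrank F (RestrictedH2 P) =
        2 * Nat.card (TwistedHeisenberg.Pairs lam) + 3 * m ∧
      ∃ b : Module.Basis (TwistedHeisenberg.OrdIdx lam ⊕ {k : HIdx m // k ≠ HIdx.t}) F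
          (RestrictedH2 P),
        (∀ (k : TwistedHeisenberg.OrdIdx lam) (ω : TwistedHeisenberg lam → F),
          TwistedHeisenberg.IsTilde p (TwistedHeisenberg.ordCocycle lam k) ω →
          ∃ h : CochainPair.mk (TwistedHeisenberg.ordCocycle lam k) ω ∈ restrictedCocycle2 P,
            b (Sum.inl k) = restrictedClass P _ h) ∧
        (∀ k : {k : HIdx m // k ≠ HIdx.t},
          ∃ h : CochainPair.mk (0 : Cochain2 F (TwistedHeisenberg lam))
              (TwistedHeisenberg.eBar p lam k.1) ∈ restrictedCocycle2 P,
            b (Sum.inr k) = restrictedClass P _ h) := by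
  classical
  have hprime : p.Prime := (CharP.char_is_prime_or_zero F p).resolve_right (by omega)
  have : Fact p.Prime := ⟨hprime⟩
  have hodd : Odd p := hprime.odd_of_ne_two (by omega)
  have hc0 : c ≠ 0 := hc ⟨0, hm⟩ ▸ pow_ne_zero _ (hlam _)
  refine ⟨fun μ => ⟨_, TwistedHeisenberg.hasParameters_stdStructure hp hodd hc μ, fun P hP =>
      hP.unique hp hodd (TwistedHeisenberg.hasParameters_stdStructure hp hodd hc μ)⟩,
    fun k => ?_, fun P => ?_⟩
  · obtain ⟨ω, hω⟩ := TwistedHeisenberg.exists_isTilde hp hodd hlam k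
    exact ⟨ω, hω, fun ω' hω' => hω'.unique (by omega) hω⟩
  obtain ⟨μ, hP⟩ := TwistedHeisenberg.exists_hasParameters hp hodd hm hlam hc P
  have hl : ((⟨m - 1, by omega⟩ : Fin m) : ℕ) + 1 = m := Nat.sub_add_cancel hm
  obtain ⟨E, hE⟩ := TwistedHeisenberg.exists_cohomEquiv hp hodd hlam hc0 hc hP hl
  have : Finite {k : HIdx m // k ≠ HIdx.t} :=
    Finite.of_equiv _ (TwistedHeisenberg.neTEquiv m).symm
  refine ⟨⟨μ, hP⟩, ?_, Module.Basis.ofEquivFun E, fun k ω hω => ?_, fun k => ?_⟩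
  · rw [Module.finrank_eq_nat_card_basis (Module.Basis.ofEquivFun E),
      TwistedHeisenberg.card_basisIdx hm]
  · refine ⟨TwistedHeisenberg.mk_ordCocycle_mem hp hodd hlam hc hP k hω.1, ?_⟩
    rw [Module.Basis.coe_ofEquivFun, LinearEquiv.symm_apply_eq, hE,
      TwistedHeisenberg.cohomCoord_ordCocycle hl k hω.2]
  · refine ⟨TwistedHeisenberg.mk_eBar_mem P k.1, ?_⟩
    rw [Module.Basis.coe_ofEquivFun, LinearEquiv.symm_apply_eq, hE,
      TwistedHeisenberg.cohomCoord_eBar (by omega) k]
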